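/- Let $f$ be a real function that is increasing (nondecreasing) on $[0,1]$, let $d_0\in(0,1)$, $\theta_0=f(d_0)$, and assume $f\in\mathscr F$: in a neighbourhood of $d_0$, $f$ has a positive continuous first derivative, and its third derivative exists and is uniformly bounded there. (Outside $[0,1]$ the values of $f$ are arbitrary.) Fix $p\in(0,1)$, $K>0$ and $\gamma\in(0,1/3)$. For each total budget $n$ let $n_1=\lfloor np\rfloor$ if $n-\lfloor np\rfloor$ is even and $n_1=\lfloor np\rfloor+1$ otherwise, and let $n_2=(n-n_1)/2$. *Design.* For each $n$ let $x_1<\dots<x_{n_1}$ be points of $[0,1]$ (depending on $n$) such that (A1) holds: there is a distribution function $G$ with a Lebesgue density $g$ such that $G$ is differentiable at $d_0$ with $G'(d_0)=g(d_0)>0$, and $\sup_{x\in[0,1]}|F_n(x)-G(x)|=o(n_1^{-1/3})$ as $n\to\infty$, where $F_n$ is the empirical distribution function of $x_1,\dots,x_{n_1}$. *Errors.* Let $\varepsilon$ be a real random variable with $\mathbb E\varepsilon=0$, $\mathbb E\varepsilon^2=\sigma^2$, $\sigma>0$, and $\mathbb E\varepsilon^6<\infty$. On a probability space $(\Omega,\mathscr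 A,P)$, for each $n$, let $\varepsilon_i,\varepsilon_i',\varepsilon_i''$ $(1\le i\le n)$ (depending on $n$) be independent copies of $\varepsilon$. *Two-stage estimator.* Let $Y_i=f(x_i)+\varepsilon_i$ for $i\le n_1$, let $\hat f$ be an isotonic regression of these data, i.e. a nondecreasing function on $[0,1]$ that minimizes $\sum_{i\le n_1}(Y_i-h(x_i))^2$ over all nondecreasing functions $h$ on $[0,1]$, and let $\hat d_{n_1}^{(1)}=\inf\{x\in[0,1]:\hat f(x)\ge\theta_0\}$. Put $L=\hat d_{n_1}^{(1)}-Kn_1^{-\gamma}$, $U=\hat d_{n_1}^{(1)}+Kn_1^{-\gamma}$, and let $Y_i'=f(L)+\varepsilon_i'$, $Y_i''=f(U)+\varepsilon_i''$ for $i\le n_2$. Let $(\hat\beta_0,\hat\beta_1)$ be the least squares intercept and slope of the data $(L,Y_i'),(U,Y_i'')$, $i\le n_2$, that is, $\hat\beta_1=(2Kn_1^{-\gamma}n_2)^{-1}\sum_{i\le n_2}(Y_i''-Y_i')$ and $\hat\beta_0=(2n_2)^{-1}\sum_{i\le n_2}(Y_i''+Y_i')-\hat d_{n_1}^{(1)}\hat\beta_1$,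 and let $\tilde d_n^{(2)}=(\theta_0-\hat\beta_0)/\hat\beta_1$. *Bootstrap.* Given the data, let $Y_i'^{\star}$ and $Y_i''^{\star}$, $i\le n_2$, be independent samples drawn with replacement from $\{Y_i'\}_{i\le n_2}$ and $\{Y_i''\}_{i\le n_2}$, respectively; let $\tilde d_n^{(2)\star}$ be computed from them by the same formulas, with the same $\hat d_{n_1}^{(1)}$, $L$, $U$; and let $P^\star$ be the probability of the bootstrap samples conditional on the data. Then $$\sup_{t\in\mathbb R}\Bigl|P^\star\bigl(n^{1/2}(\tilde d_n^{(2)\star}-\tilde d_n^{(2)})\le t\bigr)-P(C_2Z_1\le t)\Bigr|\xrightarrow{\;P\;}0\qquad(n\to\infty),$$ where $Z_1$ is standard normal and $C_2=\sigma/[f'(d_0)(1-p)^{1/2}]$. -/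

import Mathlib

open MeasureTheory ProbabilityTheory Filter Topology Asymptotics

noncomputable section

/-! ### The regression function -/

/-- The class `𝓕₀`: `f` is increasing (nondecreasing) on `[0,1]` and has a positive continuous first
derivative in a neighbourhood of `d₀`. Values of `f` outside `[0,1]` are unrestricted. -/
def ClassF0 (d₀ : ℝ) (f : ℝ → ℝ) : Prop :=
  MonotoneOn f (Set.Icc 0 1) ∧
    ∀ᶠ x in 𝓝 d₀, DifferentiableAt ℝ f x ∧ 0 < deriv f x ∧ ContinuousAt (deriv f) x

/-- The class `𝓕`: members of `𝓕₀` whose third derivative exists and is uniformly bounded in a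
neighbourhood of `d₀`. -/
def ClassF (d₀ : ℝ) (f : ℝ → ℝ) : Prop :=
  ClassF0 d₀ f ∧
    ∃ B : ℝ, ∀ᶠ x in 𝓝 d₀, DifferentiableAt ℝ (deriv f) x ∧
      DifferentiableAt ℝ (deriv (deriv f)) x ∧ |deriv (deriv (deriv f)) x| ≤ B

/-! ### Sample sizes -/

/-- First-stage sample size: `⌊np⌋` if `n - ⌊np⌋` is even, and `⌊np⌋ + 1` otherwise. -/
def stageOneSize (p : ℝ) (n : ℕ) : ℕ :=
  if Even (n - ⌊(n : ℝ) * p⌋₊) then ⌊(n : ℝ) * p⌋₊ else ⌊(n : ℝ) * p⌋₊ + 1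

/-- Second-stage sample size at each of the two points: `n = n₁ + 2 n₂`. -/
def stageTwoSize (p : ℝ) (n : ℕ) : ℕ := (n - stageOneSize p n) / 2

/-! ### The first-stage design -/

/-- The empirical distribution function of the points `x 0, …, x (m - 1)`. -/
def empiricalCDF (m : ℕ) (x : ℕ → ℝ) (t : ℝ) : ℝ :=
  (((Finset.range m).filter fun i => x i ≤ t).card : ℝ) / m

/-- The design assumption for a triangular array whose `n`-th row consists of the `m n` points
`x n 0, …, x n (m n - 1)`: there is a distribution function `G` with Lebesgue density `g`, positive
at `d₀`, such that `sup_{t ∈ [0,1]} |F_n(t) - G(t)| = o(m_n^{-1/3})`. As a density is determined only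
almost everywhere, its value at `d₀` is read as the derivative of `G` there. -/
def DesignA1 (m : ℕ → ℕ) (x : ℕ → ℕ → ℝ) (d₀ : ℝ) : Prop :=
  ∃ (ν : Measure ℝ) (g : ℝ → ℝ), IsProbabilityMeasure ν ∧ Measurable g ∧ (∀ t, 0 ≤ g t) ∧
    ν = volume.withDensity (fun t => ENNReal.ofReal (g t)) ∧
    HasDerivAt (cdf ν) (g d₀) d₀ ∧ 0 < g d₀ ∧
    (fun n => ⨆ t : Set.Icc (0 : ℝ) 1, |empiricalCDF (m n) (x n) t - cdf ν t|)
      =o[atTop] fun n => (m n : ℝ) ^ (-(1 / 3) : ℝ)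

/-! ### Isotonic regression and the first-stage estimator -/

/-- `fhat` is an isotonic regression on `[0,1]` of the data `(x i, Y i)`, `i < m`: it minimizes the
residual sum of squares over all nondecreasing functions on `[0,1]`. Its values at the design points
are unique; in between any nondecreasing interpolation is allowed. -/
def IsIsotonicRegression (m : ℕ) (x Y : ℕ → ℝ) (fhat : ℝ → ℝ) : Prop :=
  MonotoneOn fhat (Set.Icc 0 1) ∧
    ∀ h : ℝ → ℝ, MonotoneOn h (Set.Icc 0 1) →
      ∑ i ∈ Finset.range m, (Y i - fhat (x i)) ^ 2 ≤ ∑ i ∈ Finset.range m, (Y i - h (x i)) ^ 2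

/-- The inverse estimate `inf {x ∈ [0,1] : fhat x ≥ θ}`. -/
def inverseAt (fhat : ℝ → ℝ) (θ : ℝ) : ℝ := sInf {x | x ∈ Set.Icc (0 : ℝ) 1 ∧ θ ≤ fhat x}

/-! ### The second-stage estimator

`d` is the first-stage estimate, `h` the half-width, and `y'`, `y''` the responses at `d - h` and
`d + h`, respectively. -/

/-- Least squares slope. -/
def lsSlope {m : ℕ} (h : ℝ) (y' y'' : Fin m → ℝ) : ℝ :=
  (2 * h * m)⁻¹ * ∑ i, (y'' i - y' i)

/-- Least squares intercept. -/
def lsIntercept {m : ℕ} (d h : ℝ) (y' y'' : Fin m → ℝ) : ℝ :=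
  (2 * (m : ℝ))⁻¹ * ∑ i, (y'' i + y' i) - d * lsSlope h y' y''

/-- The two-stage estimator: the point where the fitted line takes the value `θ`. -/
def twoStageEst {m : ℕ} (θ d h : ℝ) (y' y'' : Fin m → ℝ) : ℝ :=
  (θ - lsIntercept d h y' y'') / lsSlope h y' y''

/-! ### The bootstrap -/

/-- The empirical measure of `y`. -/
def empiricalMeasure {m : ℕ} (y : Fin m → ℝ) : Measure ℝ :=
  (m : ENNReal)⁻¹ • ∑ i, Measure.dirac (y i)

/-- `P⋆`, the law of the pair of bootstrap samples given the data: two independent samples of size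
`m`, drawn with replacement from `y'` and from `y''`, respectively. -/
def bootstrapMeasure {m : ℕ} (y' y'' : Fin m → ℝ) : Measure ((Fin m → ℝ) × (Fin m → ℝ)) :=
  (Measure.pi fun _ : Fin m => empiricalMeasure y').prod
    (Measure.pi fun _ : Fin m => empiricalMeasure y'')

/-- `P⋆(n^{1/2} (d̃⋆ - d̃) ≤ t)`. -/
def bootstrapCDF {m : ℕ} (n : ℕ) (θ d h : ℝ) (y' y'' : Fin m → ℝ) (t : ℝ) : ℝ :=
  (bootstrapMeasure y' y'').real
    {q | √(n : ℝ) * (twoStageEst θ d h q.1 q.2 - twoStageEst θ d h y' y'') ≤ t}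

/-! ### Checks of the definitions -/

theorem empiricalMeasure_isProbabilityMeasure {m : ℕ} (hm : m ≠ 0) (y : Fin m → ℝ) :
    IsProbabilityMeasure (empiricalMeasure y) := by
  constructor
  simp [empiricalMeasure]
  exact ENNReal.inv_mul_cancel (by simpa using hm) (by simp)

theorem stageOneSize_add_two_mul (p : ℝ) (hp1 : p < 1) (n : ℕ) :
    stageOneSize p n + 2 * stageTwoSize p n = n := by
  have h : ⌊(n : ℝ) * p⌋₊ ≤ n := by
    apply Nat.floor_le_of_le
    nlinarith [(Nat.cast_nonneg n : (0 : ℝ) ≤ n)]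
  unfold stageTwoSize stageOneSize
  split_ifs with he
  · obtain ⟨k, hk⟩ := he
    omega
  · rw [Nat.not_even_iff_odd] at he
    obtain ⟨k, hk⟩ := he
    omega

theorem sum_sub_mean_sq_le {m : ℕ} (y : Fin m → ℝ) (c : ℝ) :
    ∑ i, (y i - (m : ℝ)⁻¹ * ∑ j, y j) ^ 2 ≤ ∑ i, (y i - c) ^ 2 := by
  rcases Nat.eq_zero_or_pos m with rfl | hm
  · simp
  have hm' : (0 : ℝ) < m := by exact_mod_cast hm
  set s := ∑ j, y j with hs
  have key : ∀ a : ℝ, ∑ i, (y i - a) ^ 2 = ∑ i, y i ^ 2 - 2 * a * s + m * a ^ 2 := by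
    intro a
    simp only [sub_sq, Finset.sum_add_distrib, Finset.sum_sub_distrib, Finset.sum_const,
      Finset.card_univ, Fintype.card_fin, nsmul_eq_mul, hs, Finset.mul_sum]
    congr 2
    exact Finset.sum_congr rfl fun i _ => by ring
  rw [key, key]
  have : s = m * ((m : ℝ)⁻¹ * s) := by field_simp
  set a := (m : ℝ)⁻¹ * s
  rw [this]
  nlinarith [mul_nonneg hm'.le (sq_nonneg (a - c))]

/-- `lsIntercept`, `lsSlope` are the least squares coefficients of the model `y = β₀ + β₁ x`. -/
theorem ls_minimizes {m : ℕ} {h : ℝ} (hh : h ≠ 0) (d : ℝ) (y' y'' : Fin m → ℝ) (b₀ b₁ : ℝ) :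
    ∑ i, ((y' i - lsIntercept d h y' y'' - lsSlope h y' y'' * (d - h)) ^ 2 +
        (y'' i - lsIntercept d h y' y'' - lsSlope h y' y'' * (d + h)) ^ 2) ≤
      ∑ i, ((y' i - b₀ - b₁ * (d - h)) ^ 2 + (y'' i - b₀ - b₁ * (d + h)) ^ 2) := by
  rcases Nat.eq_zero_or_pos m with rfl | hm
  · simp
  have hm' : (m : ℝ) ≠ 0 := by positivity
  have e1 : lsIntercept d h y' y'' + lsSlope h y' y'' * (d - h) = (m : ℝ)⁻¹ * ∑ j, y' j := by
    simp only [lsIntercept, lsSlope, Finset.sum_add_distrib, Finset.sum_sub_distrib]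
    field_simp
    ring
  have e2 : lsIntercept d h y' y'' + lsSlope h y' y'' * (d + h) = (m : ℝ)⁻¹ * ∑ j, y'' j := by
    simp only [lsIntercept, lsSlope, Finset.sum_add_distrib, Finset.sum_sub_distrib]
    field_simp
    ring
  simp only [sub_sub, e1, e2, Finset.sum_add_distrib]
  exact add_le_add (sum_sub_mean_sq_le y' _) (sum_sub_mean_sq_le y'' _)

/-- An isotonic regression exists for every set of data. -/
theorem exists_isIsotonicRegression (m : ℕ) (x Y : ℕ → ℝ) (hx : ∀ i < m, x i ∈ Set.Icc (0 : ℝ) 1) :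
    ∃ fhat, IsIsotonicRegression m x Y fhat := by
  let C : Set (EuclideanSpace ℝ (Fin m)) := {u | ∀ i j : Fin m, x i ≤ x j → u i ≤ u j}
  have hne : C.Nonempty := ⟨0, fun i j _ => le_rfl⟩
  have hcl : IsClosed C := by
    simp only [C, Set.ofPred_forall]
    refine isClosed_iInter fun i => isClosed_iInter fun j => isClosed_iInter fun _ => ?_
    exact isClosed_le (by fun_prop) (by fun_prop)
  have hcv : Convex ℝ C := by
    intro u hu v hv a b ha hb _ i j hij
    have h1 := mul_le_mul_of_nonneg_left (hu i j hij) ha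
    have h2 := mul_le_mul_of_nonneg_left (hv i j hij) hb
    exact add_le_add h1 h2
  let y : EuclideanSpace ℝ (Fin m) := WithLp.toLp 2 fun i => Y i
  obtain ⟨u, huC, hu⟩ := exists_norm_eq_iInf_of_complete_convex hne hcl.isComplete hcv y
  have hmin : ∀ v ∈ C, ‖y - u‖ ≤ ‖y - v‖ := by
    intro v hv
    rw [hu]
    exact ciInf_le ⟨0, by rintro _ ⟨w, rfl⟩; exact norm_nonneg _⟩ (⟨v, hv⟩ : C)
  classical
  let φ : ℝ → ℝ := fun t => if h : ∃ i : Fin m, x i = t then u h.choose else 0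
  have hφ : ∀ i : Fin m, φ (x i) = u i := by
    intro i
    have h : ∃ j : Fin m, x j = x i := ⟨i, rfl⟩
    simp only [φ, dif_pos h]
    exact le_antisymm (huC _ _ h.choose_spec.le) (huC _ _ h.choose_spec.ge)
  have hmono : MonotoneOn φ (Set.range fun i : Fin m => x i) := by
    rintro _ ⟨i, rfl⟩ _ ⟨j, rfl⟩ hij
    simp only [hφ]
    exact huC i j hij
  have hfin : (φ '' Set.range fun i : Fin m => x i).Finite := (Set.finite_range _).image _
  obtain ⟨g, hg, hgφ⟩ := hmono.exists_monotone_extension hfin.bddBelow hfin.bddAbove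
  refine ⟨g, hg.monotoneOn _, fun h hh => ?_⟩
  have hgu : ∀ i : Fin m, g (x i) = u i := fun i => by rw [← hgφ ⟨i, rfl⟩, hφ]
  have hv := hmin (WithLp.toLp 2 fun i => h (x i))
    (fun i j hij => hh (hx i i.2) (hx j j.2) hij)
  rw [← sq_le_sq₀ (norm_nonneg _) (norm_nonneg _), EuclideanSpace.real_norm_sq_eq,
    EuclideanSpace.real_norm_sq_eq] at hv
  simp only [Finset.sum_range]
  simpa [hgu, y] using hv

end

/-! ### Characteristic functions of bootstrap sums -/

/-! The bootstrap recentres at the estimate itself, so only the spread of the resampled means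
matters. Let b be the fitted slope, b⋆ its resampled value, h the half-width, m = n₂, and let S, T
be the sums of the two resampled sets of responses, centred at the sample means. When b, b⋆ > 0,
clearing denominators turns √n (d̃⋆ - d̃) ≤ t into an exact linear inequality in (S, T)
(`sqrt_mul_twoStageEst_sub_le_iff`); both weights are -√n / (2 m b), up to factors 1 ∓ κ with κ → 0.
Since S and T are independent with variance about m σ² each, the limit variance is lim n σ² / (2 m
f'(d₀)²) = C₂². The event b⋆ ≤ 0 is also a linear inequality, for a statistic whose variance tends
to 0 because n h² → ∞.

The central limit theorem for S and T is a statement about deterministic arrays: it needs only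
convergent sample variances and bounded third sample moments (`tendsto_real_bootLin_le`). Pólya's
argument makes the convergence uniform in t.

The data enter through finitely many statistics: noise averages that are o(h), second and third
sample moments that converge, and a first-stage error that is o(h), all in probability.
Differentiability of f at d₀ then gives b → f'(d₀), while the first-order terms cancel in the mean
of the two responses and leave a bias o(h). `tendstoInMeasure_of_forall_seq` reduces the theorem to
sequences along which these statistics converge, so the rest is deterministic.

Chebyshev's inequality and the sixth moment handle the noise. The first-stage error is o(h) because
n₁ h³ → ∞ (`tendsto_measure_lt_abs_inverseAt_sub`): a miss by more than r puts the isotonic fit on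
the wrong side of the level at d₀ + r or d₀ - r, and optimality of the fit forces a noise average of
order r over a block with one fixed end and at least order n₁ r points. The Hájek–Rényi inequality
bounds the probability of such a block by a constant over n₁ r³. -/

theorem integral_empiricalMeasure {m : ℕ} (y : Fin m → ℝ) (g : ℝ → ℂ) :
    ∫ z, g z ∂(empiricalMeasure y) = (m : ℂ)⁻¹ * ∑ i, g (y i) := by
  rw [empiricalMeasure, integral_smul_measure, integral_finsetSum_measure]
  · simp [integral_dirac, Complex.real_smul]
  · intro i _
    exact integrable_dirac (by simp)

/-- The sample mean. -/
noncomputable def sampleMean {m : ℕ} (y : Fin m → ℝ) : ℝ := (m : ℝ)⁻¹ * ∑ i, y i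

/-- The sample variance, normalized by the sample size. -/
noncomputable def sampleVar {m : ℕ} (y : Fin m → ℝ) : ℝ :=
  (m : ℝ)⁻¹ * ∑ i, (y i - sampleMean y) ^ 2

/-- The third absolute central sample moment. -/
noncomputable def sampleThird {m : ℕ} (y : Fin m → ℝ) : ℝ :=
  (m : ℝ)⁻¹ * ∑ i, |y i - sampleMean y| ^ 3

/-- The characteristic function of the centered empirical measure. -/
noncomputable def empCharFun {m : ℕ} (y : Fin m → ℝ) (v : ℝ) : ℂ :=
  (m : ℂ)⁻¹ * ∑ i, Complex.exp ((v * (y i - sampleMean y) : ℝ) * Complex.I)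

theorem sum_sub_sampleMean {m : ℕ} (hm : m ≠ 0) (y : Fin m → ℝ) :
    ∑ i, (y i - sampleMean y) = 0 := by
  have : (m : ℝ) ≠ 0 := by exact_mod_cast hm
  simp [sampleMean, Finset.sum_sub_distrib]
  field_simp
  ring

theorem sampleVar_nonneg {m : ℕ} (y : Fin m → ℝ) : 0 ≤ sampleVar y := by
  unfold sampleVar; positivity

/-- The Taylor remainder is used for |x| ≤ 1, where the factor e is at most 4. For |x| > 1 the
triangle inequality suffices, since every lower power is at most |x|³. -/
theorem norm_cexp_mul_I_sub_taylor_le (x : ℝ) :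
    ‖Complex.exp (x * Complex.I) - (1 + x * Complex.I - x ^ 2 / 2)‖ ≤ 4 * |x| ^ 3 := by
  rcases le_or_gt |x| 1 with h | h
  · have h1 := Complex.norm_exp_sub_sum_le_norm_mul_exp (x * Complex.I) 3
    have h2 : ∑ k ∈ Finset.range 3, ((x : ℂ) * Complex.I) ^ k / (k.factorial : ℂ)
        = 1 + x * Complex.I - x ^ 2 / 2 := by
      simp [Finset.sum_range_succ, mul_pow, Nat.factorial]
      ring
    rw [h2] at h1
    refine h1.trans ?_
    have h3 : ‖(x : ℂ) * Complex.I‖ = |x| := by simp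
    rw [h3, mul_comm]
    gcongr
    calc Real.exp |x| ≤ Real.exp 1 := Real.exp_le_exp.2 h
      _ ≤ 4 := by linarith [Real.exp_one_lt_d9]
  · have h1 : ‖Complex.exp (x * Complex.I)‖ = 1 := Complex.norm_exp_ofReal_mul_I x
    have h2 : ‖(1 + x * Complex.I - x ^ 2 / 2 : ℂ)‖ ≤ 1 + |x| + |x| ^ 2 / 2 := by
      refine (norm_sub_le _ _).trans (add_le_add ((norm_add_le _ _).trans ?_) ?_) <;> simp
    refine (norm_sub_le _ _).trans ?_
    rw [h1]
    have h3 : 1 ≤ |x| ^ 3 := one_le_pow₀ h.le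
    have h4 : |x| ≤ |x| ^ 3 := le_self_pow₀ h.le (by norm_num)
    have h5 : |x| ^ 2 ≤ |x| ^ 3 := pow_le_pow_right₀ h.le (by norm_num)
    linarith

theorem norm_empCharFun_le {m : ℕ} (hm : m ≠ 0) (y : Fin m → ℝ) (v : ℝ) :
    ‖empCharFun y v‖ ≤ 1 := by
  unfold empCharFun
  rw [norm_mul, norm_inv, Complex.norm_natCast]
  have : ‖∑ i, Complex.exp ((v * (y i - sampleMean y) : ℝ) * Complex.I)‖ ≤ m := by
    refine (norm_sum_le _ _).trans ?_
    simp only [Complex.norm_exp_ofReal_mul_I]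
    simp
  calc (m : ℝ)⁻¹ * _ ≤ (m : ℝ)⁻¹ * m := by gcongr
    _ = 1 := inv_mul_cancel₀ (by exact_mod_cast hm)

/-- Centring kills the linear Taylor term, and the cubic remainders average to the third sample
moment. -/
theorem norm_empCharFun_sub_le {m : ℕ} (hm : m ≠ 0) (y : Fin m → ℝ) (v : ℝ) :
    ‖empCharFun y v - (1 - v ^ 2 * sampleVar y / 2 : ℝ)‖ ≤ 4 * |v| ^ 3 * sampleThird y := by
  have hm' : (m : ℂ) ≠ 0 := by exact_mod_cast hm
  have h0 := sum_sub_sampleMean hm y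
  have key : empCharFun y v - (1 - v ^ 2 * sampleVar y / 2 : ℝ)
      = (m : ℂ)⁻¹ * ∑ i, (Complex.exp ((v * (y i - sampleMean y) : ℝ) * Complex.I)
          - (1 + (v * (y i - sampleMean y) : ℝ) * Complex.I
            - ((v * (y i - sampleMean y) : ℝ) : ℂ) ^ 2 / 2)) := by
    have h1 : ∑ i, ((1 : ℂ) + (v * (y i - sampleMean y) : ℝ) * Complex.I
            - ((v * (y i - sampleMean y) : ℝ) : ℂ) ^ 2 / 2)
        = m + ((v * ∑ i, (y i - sampleMean y) : ℝ) : ℂ) * Complex.I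
          - ((v ^ 2 * ∑ i, (y i - sampleMean y) ^ 2 / 2 : ℝ) : ℂ) := by
      push_cast
      rw [Finset.sum_sub_distrib, Finset.sum_add_distrib]
      simp only [Finset.sum_const, Finset.card_univ, Fintype.card_fin, Finset.mul_sum,
        Finset.sum_mul]
      simp
      congr 1
      funext i
      ring
    rw [Finset.sum_sub_distrib, h1, h0, mul_sub, empCharFun, sampleVar]
    push_cast
    rw [← Finset.sum_div]
    linear_combination inv_mul_cancel₀ hm'
  rw [key, norm_mul, norm_inv, Complex.norm_natCast, sampleThird]
  calc (m : ℝ)⁻¹ * _ ≤ (m : ℝ)⁻¹ * ∑ i, 4 * |v * (y i - sampleMean y)| ^ 3 := by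
        gcongr
        refine (norm_sum_le _ _).trans (Finset.sum_le_sum fun i _ => ?_)
        exact norm_cexp_mul_I_sub_taylor_le _
    _ = _ := by
        simp only [abs_mul, mul_pow, Finset.mul_sum]
        exact Finset.sum_congr rfl fun i _ => by ring

theorem norm_pow_sub_pow_le_of_norm_le_one {z w : ℂ} (hz : ‖z‖ ≤ 1) (hw : ‖w‖ ≤ 1) (m : ℕ) :
    ‖z ^ m - w ^ m‖ ≤ m * ‖z - w‖ := by
  induction m with
  | zero => simp
  | succ k ih =>
    have : z ^ (k + 1) - w ^ (k + 1) = (z ^ k - w ^ k) * z + w ^ k * (z - w) := by ring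
    rw [this]
    refine (norm_add_le _ _).trans ?_
    rw [norm_mul, norm_mul, norm_pow]
    have h1 : ‖w‖ ^ k ≤ 1 := pow_le_one₀ (norm_nonneg _) hw
    push_cast
    nlinarith [mul_le_mul_of_nonneg_left hz (norm_nonneg (z ^ k - w ^ k)),
      mul_le_mul_of_nonneg_right h1 (norm_nonneg (z - w))]

/-- Compare with the m-th power of exp(-x), where x = v² · variance / 2. In the closed unit disc the
powers differ by at most m times the difference of the bases, that is m (4 |v|³ C + x²). This
vanishes because v² m is bounded and v → 0. -/
theorem tendsto_empCharFun_pow {ι : Type*} {l : Filter ι} {m : ι → ℕ}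
    (hm : Tendsto m l atTop)
    (y : (k : ι) → Fin (m k) → ℝ) (v : ι → ℝ) {τ V C : ℝ}
    (hv : Tendsto (fun k => (v k) ^ 2 * m k) l (𝓝 τ))
    (hV : Tendsto (fun k => sampleVar (y k)) l (𝓝 V))
    (hC : ∀ᶠ k in l, sampleThird (y k) ≤ C) :
    Tendsto (fun k => empCharFun (y k) (v k) ^ m k) l (𝓝 (Complex.exp (-(τ * V / 2) : ℝ))) := by
  have hmR : Tendsto (fun k => (m k : ℝ)) l atTop := tendsto_natCast_atTop_atTop.comp hm
  have hm0 : ∀ᶠ k in l, m k ≠ 0 := hm.eventually_ne_atTop 0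
  have hv2 : Tendsto (fun k => (v k) ^ 2) l (𝓝 0) := by
    have := hv.mul (tendsto_inv_atTop_zero.comp hmR)
    rw [mul_zero] at this
    refine this.congr' ?_
    filter_upwards [hm0] with k hk
    have : (m k : ℝ) ≠ 0 := by exact_mod_cast hk
    simp [this]
  have hv1 : Tendsto (fun k => |v k|) l (𝓝 0) := by
    have := hv2.sqrt
    simpa [Real.sqrt_sq_eq_abs] using this
  let x : ι → ℝ := fun k => v k ^ 2 * sampleVar (y k) / 2
  have hx0 : ∀ k, 0 ≤ x k := fun k => by
    have := sampleVar_nonneg (y k); positivity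
  have hx : Tendsto x l (𝓝 0) := by
    have := (hv2.mul hV).div_const 2
    simpa using this
  have hmx : Tendsto (fun k => m k * x k) l (𝓝 (τ * V / 2)) := by
    refine ((hv.mul hV).div_const 2).congr fun k => ?_
    simp only [x]; ring
  have hw : Tendsto (fun k => Complex.exp ((-x k : ℝ) : ℂ) ^ m k) l
      (𝓝 (Complex.exp (-(τ * V / 2) : ℝ))) := by
    have : Tendsto (fun k => Complex.exp ((-(m k * x k) : ℝ) : ℂ)) l
        (𝓝 (Complex.exp (-(τ * V / 2) : ℝ))) :=
      (Complex.continuous_exp.tendsto _).comp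
        ((Complex.continuous_ofReal.tendsto _).comp hmx.neg)
    refine this.congr fun k => ?_
    rw [← Complex.exp_nat_mul]
    congr 1
    push_cast
    ring
  have hdiff : Tendsto (fun k => empCharFun (y k) (v k) ^ m k
      - Complex.exp ((-x k : ℝ) : ℂ) ^ m k) l (𝓝 0) := by
    have hb : Tendsto (fun k => 4 * |v k| * ((v k) ^ 2 * m k) * C + (m k * x k) * x k) l
        (𝓝 0) := by
      have := (((hv1.const_mul 4).mul hv).mul_const C).add (hmx.mul hx)
      simpa using this
    refine squeeze_zero_norm' ?_ hb
    filter_upwards [hm0, hC, hx.eventually (ge_mem_nhds (zero_lt_one))] with k hk hCk hxk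
    have hw1 : ‖Complex.exp ((-x k : ℝ) : ℂ)‖ ≤ 1 := by
      rw [← Complex.ofReal_exp, Complex.norm_real, Real.norm_eq_abs, abs_of_pos (Real.exp_pos _)]
      exact Real.exp_le_one_iff.2 (by linarith [hx0 k])
    refine (norm_pow_sub_pow_le_of_norm_le_one (norm_empCharFun_le hk _ _) hw1 _).trans ?_
    have h1 := norm_empCharFun_sub_le hk (y k) (v k)
    have h2 : ‖((1 - x k : ℝ) : ℂ) - Complex.exp ((-x k : ℝ) : ℂ)‖ ≤ x k ^ 2 := by
      rw [← Complex.ofReal_exp, ← Complex.ofReal_sub, Complex.norm_real, norm_sub_rev,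
        Real.norm_eq_abs]
      have := Real.abs_exp_sub_one_sub_id_le (x := -x k) (by rwa [abs_neg, abs_of_nonneg (hx0 k)])
      rw [neg_sq] at this
      convert this using 2
      ring
    have h3 : ‖empCharFun (y k) (v k) - Complex.exp ((-x k : ℝ) : ℂ)‖
        ≤ 4 * |v k| ^ 3 * C + x k ^ 2 := by
      refine (norm_sub_le_norm_sub_add_norm_sub _ ((1 - x k : ℝ) : ℂ) _).trans ?_
      refine add_le_add (h1.trans ?_) h2
      gcongr
    refine (mul_le_mul_of_nonneg_left h3 (Nat.cast_nonneg _)).trans (le_of_eq ?_)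
    rw [← sq_abs (v k)]
    ring
  have := hdiff.add hw
  simpa using this

/-- The linear bootstrap statistic with weights `c` and `c'` on the centered sums. -/
noncomputable def bootLin {m : ℕ} (y' y'' : Fin m → ℝ) (c c' : ℝ)
    (q : (Fin m → ℝ) × (Fin m → ℝ)) : ℝ :=
  c * ∑ i, (q.1 i - sampleMean y') + c' * ∑ i, (q.2 i - sampleMean y'')

theorem measurable_bootLin {m : ℕ} (y' y'' : Fin m → ℝ) (c c' : ℝ) :
    Measurable (bootLin y' y'' c c') := by
  unfold bootLin; fun_prop

theorem isProbabilityMeasure_bootstrapMeasure {m : ℕ} (hm : m ≠ 0) (y' y'' : Fin m → ℝ) :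
    IsProbabilityMeasure (bootstrapMeasure y' y'') := by
  have := empiricalMeasure_isProbabilityMeasure hm y'
  have := empiricalMeasure_isProbabilityMeasure hm y''
  unfold bootstrapMeasure
  infer_instance

/-- The 2m resampled values are independent, so the characteristic function factors. -/
theorem charFun_map_bootLin {m : ℕ} (hm : m ≠ 0) (y' y'' : Fin m → ℝ) (c c' s : ℝ) :
    charFun ((bootstrapMeasure y' y'').map (bootLin y' y'' c c')) s
      = empCharFun y' (s * c) ^ m * empCharFun y'' (s * c') ^ m := by
  have := empiricalMeasure_isProbabilityMeasure hm y'
  have := empiricalMeasure_isProbabilityMeasure hm y''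
  have hpi : ∀ (y : Fin m → ℝ) (v : ℝ) [IsProbabilityMeasure (empiricalMeasure y)],
      ∫ q : Fin m → ℝ, ∏ i, Complex.exp ((v * (q i - sampleMean y) : ℝ) * Complex.I)
        ∂(Measure.pi fun _ => empiricalMeasure y) = empCharFun y v ^ m := by
    intro y v _
    rw [integral_fintype_prod_eq_pow (μ := empiricalMeasure y)
      (fun z => Complex.exp ((v * (z - sampleMean y) : ℝ) * Complex.I)),
      integral_empiricalMeasure, Fintype.card_fin, empCharFun]
  rw [charFun_apply_real, integral_map (measurable_bootLin ..).aemeasurable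
    (by fun_prop), ← hpi y', ← hpi y'', bootstrapMeasure, ← integral_prod_mul]
  refine integral_congr_ae (.of_forall fun q => ?_)
  simp only [bootLin, ← Complex.exp_sum, ← Complex.exp_add]
  congr 1
  push_cast
  simp only [← Finset.sum_mul, ← Finset.mul_sum]
  ring

/-! ### The conditional central limit theorem for bootstrap sums -/

/-- Lévy's continuity theorem followed by the portmanteau theorem. The limit variance may be 0,
hence the assumption that `x` is not an atom; the degenerate case is what rules out a nonpositive
resampled slope. -/
theorem tendsto_real_bootLin_le {m : ℕ → ℕ} (hm : Tendsto m atTop atTop)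
    (y' y'' : (k : ℕ) → Fin (m k) → ℝ) (c c' : ℕ → ℝ) {τ τ' V C x : ℝ}
    (hτ0 : 0 ≤ τ) (hτ0' : 0 ≤ τ') (hV0 : 0 ≤ V)
    (hc : Tendsto (fun k => (c k) ^ 2 * m k) atTop (𝓝 τ))
    (hc' : Tendsto (fun k => (c' k) ^ 2 * m k) atTop (𝓝 τ'))
    (hV : Tendsto (fun k => sampleVar (y' k)) atTop (𝓝 V))
    (hV' : Tendsto (fun k => sampleVar (y'' k)) atTop (𝓝 V))
    (hC : ∀ᶠ k in atTop, sampleThird (y' k) ≤ C)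
    (hC' : ∀ᶠ k in atTop, sampleThird (y'' k) ≤ C)
    (hx : gaussianReal 0 ((τ + τ') * V).toNNReal {x} = 0) :
    Tendsto (fun k => (bootstrapMeasure (y' k) (y'' k)).real
        {q | bootLin (y' k) (y'' k) (c k) (c' k) q ≤ x}) atTop
      (𝓝 ((gaussianReal 0 ((τ + τ') * V).toNNReal).real (Set.Iic x))) := by
  have hm0 : ∀ᶠ k in atTop, m k ≠ 0 := hm.eventually_ne_atTop 0
  -- The Dirac mass is a default for the finitely many `k` with `m k = 0`.
  let μ : ℕ → ProbabilityMeasure ℝ := fun k =>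
    if h : m k ≠ 0 then
      ⟨(bootstrapMeasure (y' k) (y'' k)).map (bootLin (y' k) (y'' k) (c k) (c' k)), by
        have := isProbabilityMeasure_bootstrapMeasure h (y' k) (y'' k)
        exact Measure.isProbabilityMeasure_map (measurable_bootLin ..).aemeasurable⟩
    else ⟨Measure.dirac 0, inferInstance⟩
  let μ₀ : ProbabilityMeasure ℝ := ⟨gaussianReal 0 ((τ + τ') * V).toNNReal, inferInstance⟩
  have hμ : ∀ k, m k ≠ 0 → ((μ k : ProbabilityMeasure ℝ) : Measure ℝ)
      = (bootstrapMeasure (y' k) (y'' k)).map (bootLin (y' k) (y'' k) (c k) (c' k)) := by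
    intro k hk
    have : μ k = ⟨_, _⟩ := dif_pos hk
    rw [this]
    rfl
  have hlim : Tendsto μ atTop (𝓝 μ₀) := by
    rw [ProbabilityMeasure.tendsto_iff_tendsto_charFun]
    intro s
    have hs : ∀ {a : ℕ → ℝ} {r : ℝ}, Tendsto (fun k => (a k) ^ 2 * m k) atTop (𝓝 r) →
        Tendsto (fun k => (s * a k) ^ 2 * m k) atTop (𝓝 (s ^ 2 * r)) := by
      intro a r h
      exact (h.const_mul (s ^ 2)).congr fun k => by ring
    have h1 := tendsto_empCharFun_pow hm y' _ (hs hc) hV hC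
    have h2 := tendsto_empCharFun_pow hm y'' _ (hs hc') hV' hC'
    have h3 := h1.mul h2
    have h4 : charFun (μ₀ : Measure ℝ) s = Complex.exp (-(s ^ 2 * τ * V / 2) : ℝ)
        * Complex.exp (-(s ^ 2 * τ' * V / 2) : ℝ) := by
      change charFun (gaussianReal 0 ((τ + τ') * V).toNNReal) s = _
      rw [charFun_gaussianReal, ← Complex.exp_add]
      congr 1
      have : ((((τ + τ') * V).toNNReal : ℝ) : ℂ) = (((τ + τ') * V : ℝ) : ℂ) := by
        rw [Real.coe_toNNReal _ (by positivity)]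
      rw [this]
      push_cast
      ring
    rw [h4]
    refine h3.congr' ?_
    filter_upwards [hm0] with k hk
    rw [hμ k hk, charFun_map_bootLin hk]
  have hfr : (μ₀ : Measure ℝ) (frontier (Set.Iic x)) = 0 := by
    rw [frontier_Iic]; exact hx
  have h5 := ProbabilityMeasure.tendsto_measure_of_null_frontier_of_tendsto' hlim hfr
  have h6 := (ENNReal.tendsto_toReal (measure_ne_top (μ₀ : Measure ℝ) _)).comp h5
  refine h6.congr' ?_
  filter_upwards [hm0] with k hk
  simp only [Function.comp, hμ k hk]
  rw [Measure.map_apply (measurable_bootLin ..) measurableSet_Iic]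
  rfl

/-- Pólya's theorem: convergence at the finitely many quantiles `T i` of levels i/N controls all t,
as monotone functions can move by little between neighbouring quantiles. -/
theorem tendstoUniformly_of_monotone_of_tendsto {ι : Type*} {l : Filter ι} {F : ι → ℝ → ℝ}
    {Φ : ℝ → ℝ} (hF : ∀ᶠ k in l, Monotone (F k) ∧ ∀ t, 0 ≤ F k t ∧ F k t ≤ 1)
    (hΦ : Continuous Φ) (hΦm : Monotone Φ) (h0 : Tendsto Φ atBot (𝓝 0))
    (h1 : Tendsto Φ atTop (𝓝 1)) (hlim : ∀ t, Tendsto (fun k => F k t) l (𝓝 (Φ t))) :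
    Tendsto (fun k => ⨆ t, |F k t - Φ t|) l (𝓝 0) := by
  have hΦ0 : ∀ t, 0 ≤ Φ t := fun t => hΦm.le_of_tendsto h0 t
  have hΦ1 : ∀ t, Φ t ≤ 1 := fun t => hΦm.ge_of_tendsto h1 t
  rw [Metric.tendsto_nhds]
  intro η hη
  obtain ⟨N, hN⟩ := exists_nat_gt (4 / η)
  have hNpos : (0 : ℝ) < N := lt_trans (by positivity) hN
  have hN2 : 4 < N * η := by rwa [div_lt_iff₀ hη] at hN
  have hgrid : ∀ i : ℕ, 0 < i → i < N → ∃ t, Φ t = i / N := by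
    intro i hi hiN
    have hi0 : (0 : ℝ) < i / N := by positivity
    have hi1 : (i : ℝ) / N < 1 := by
      rw [div_lt_one hNpos]; exact_mod_cast hiN
    obtain ⟨a, ha⟩ := (h0.eventually_lt_const hi0).exists
    obtain ⟨b, hb⟩ := (h1.eventually_const_lt hi1).exists
    exact mem_range_of_exists_le_of_exists_ge hΦ ⟨a, ha.le⟩ ⟨b, hb.le⟩
  choose! T hT using hgrid
  have hev : ∀ᶠ k in l, ∀ i ∈ Finset.range N, |F k (T i) - Φ (T i)| < η / 4 := by
    rw [Filter.eventually_all_finset]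
    intro i _
    have := (hlim (T i)).eventually (Metric.ball_mem_nhds _ (by positivity : 0 < η / 4))
    simpa [Real.ball_eq_Ioo, Real.dist_eq, Metric.mem_ball] using this
  filter_upwards [hF, hev] with k ⟨hmono, hb⟩ hk
  have hkey : ∀ t, |F k t - Φ t| ≤ 3 * η / 4 := by
    intro t
    rw [abs_le]
    have hpos : 0 ≤ N * Φ t := mul_nonneg hNpos.le (hΦ0 t)
    constructor
    -- The comparison point is `T (i - 1)`, not `T i`: Φ may be flat, so only the strictly lower
    -- level guarantees a quantile to the left of t. The loss is at most 2/N. For i ≤ 1 no such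
    -- quantile exists, but then Φ t itself is at most 2/N.
    · set i := ⌊N * Φ t⌋₊ with hi
      have hfl : (N : ℝ) * Φ t < i + 1 := Nat.lt_floor_add_one _
      have hfl' : (i : ℝ) ≤ N * Φ t := Nat.floor_le hpos
      clear_value i
      rcases Nat.lt_or_ge 1 i with h2 | h2
      · obtain ⟨j, rfl⟩ : ∃ j, i = j + 1 := ⟨i - 1, by omega⟩
        have hjN : j < N := by
          have : ((j : ℝ) + 1) ≤ N * 1 := by
            push_cast at hfl'
            exact hfl'.trans (mul_le_mul_of_nonneg_left (hΦ1 t) hNpos.le)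
          have : ((j + 1 : ℕ) : ℝ) ≤ (N : ℕ) := by push_cast; linarith
          have : j + 1 ≤ N := by exact_mod_cast this
          omega
        have e1 := hT j (by omega) hjN
        have e2 : T j ≤ t := by
          by_contra! hlt
          have := hΦm hlt.le
          rw [e1, le_div_iff₀ hNpos] at this
          push_cast at hfl'
          linarith
        have e3 := hmono e2
        have e4 := hk j (Finset.mem_range.2 hjN)
        rw [e1, abs_lt] at e4
        have e5 : Φ t ≤ j / N + 2 / N := by
          rw [← add_div, le_div_iff₀ hNpos]
          push_cast at hfl
          linarith
        have e6 : 2 / (N : ℝ) < η / 2 := by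
          rw [div_lt_iff₀ hNpos]; linarith
        linarith [e4.1]
      · have e5 : Φ t ≤ 2 / N := by
          rw [le_div_iff₀ hNpos]
          have : (i : ℝ) ≤ 1 := by exact_mod_cast h2
          linarith
        have e6 : 2 / (N : ℝ) < η / 2 := by
          rw [div_lt_iff₀ hNpos]; linarith
        linarith [(hb t).1]
    -- Here the level i/N strictly exceeds Φ t, so `T i` lies to the right of t. If i ≥ N, the
    -- trivial bound `F k t ≤ 1` replaces the quantile.
    · set i := ⌊N * Φ t⌋₊ + 1 with hi
      have hfl : (N : ℝ) * Φ t < i := by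
        rw [hi]; push_cast; exact Nat.lt_floor_add_one _
      have hfl' : (i : ℝ) ≤ N * Φ t + 1 := by
        rw [hi]; push_cast; linarith [Nat.floor_le hpos]
      have e6 : 1 / (N : ℝ) < η / 4 := by
        rw [div_lt_iff₀ hNpos]; linarith
      have e5 : (i : ℝ) / N ≤ Φ t + 1 / N := by
        rw [div_le_iff₀ hNpos, add_mul, div_mul_cancel₀ _ hNpos.ne']; linarith
      rcases Nat.lt_or_ge i N with h2 | h2
      · have e1 := hT i (by omega) h2
        have e2 : t ≤ T i := by
          by_contra! hlt
          have := hΦm hlt.le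
          rw [e1, div_le_iff₀ hNpos] at this
          linarith
        have e3 := hmono e2
        have e4 := hk i (Finset.mem_range.2 h2)
        rw [e1, abs_lt] at e4
        linarith [e4.2]
      · have : (1 : ℝ) ≤ i / N := by
          rw [one_le_div hNpos]; exact_mod_cast h2
        linarith [(hb t).2]
  have h3 : (⨆ t, |F k t - Φ t|) ≤ 3 * η / 4 := ciSup_le hkey
  have h4 : 0 ≤ ⨆ t, |F k t - Φ t| := Real.iSup_nonneg fun t => abs_nonneg _
  rw [Real.dist_eq, sub_zero, abs_of_nonneg h4]
  linarith

/-! ### Linearization of the bootstrapped two-stage estimator -/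

theorem lsSlope_eq {m : ℕ} (hm : m ≠ 0) {h : ℝ} (y' y'' : Fin m → ℝ) :
    lsSlope h y' y'' = (sampleMean y'' - sampleMean y') / (2 * h) := by
  have : (m : ℝ) ≠ 0 := by exact_mod_cast hm
  rw [lsSlope, sampleMean, sampleMean, Finset.sum_sub_distrib, ← mul_sub, mul_inv]
  ring

theorem twoStageEst_eq {m : ℕ} {θ d h : ℝ} (y' y'' : Fin m → ℝ)
    (hβ : lsSlope h y' y'' ≠ 0) :
    twoStageEst θ d h y' y''
      = (θ - (sampleMean y' + sampleMean y'') / 2) / lsSlope h y' y'' + d := by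
  have h1 : lsIntercept d h y' y''
      = (sampleMean y' + sampleMean y'') / 2 - d * lsSlope h y' y'' := by
    rw [lsIntercept, sampleMean, sampleMean, Finset.sum_add_distrib, mul_inv]
    ring
  rw [twoStageEst, h1]
  field_simp
  ring

theorem sampleMean_eq_add {m : ℕ} (hm : m ≠ 0) (q : Fin m → ℝ) (a : ℝ) :
    sampleMean q = a + (m : ℝ)⁻¹ * ∑ i, (q i - a) := by
  have : (m : ℝ) ≠ 0 := by exact_mod_cast hm
  rw [sampleMean, Finset.sum_sub_distrib]
  simp
  field_simp
  ring

/-- The weight correction in the linearization. -/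
noncomputable def bootCorr {m : ℕ} (n : ℕ) (θ h : ℝ) (y' y'' : Fin m → ℝ) (t : ℝ) : ℝ :=
  t / (√(n : ℝ) * h) + (θ - (sampleMean y' + sampleMean y'') / 2) / h / lsSlope h y' y''

/-- No approximation is involved. Multiplying by the positive resampled slope, which is itself
affine in the centred sums, leaves a half-plane; the slope's dependence on the sums is what
`bootCorr` records, with opposite signs for the two samples. -/
theorem sqrt_mul_twoStageEst_sub_le_iff {m n : ℕ} (hm : m ≠ 0) (hn : n ≠ 0) {θ d h t : ℝ}
    (hh : 0 < h) (y' y'' : Fin m → ℝ) (q : (Fin m → ℝ) × (Fin m → ℝ))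
    (hβ : 0 < lsSlope h y' y'') (hq : 0 < lsSlope h q.1 q.2) :
    √(n : ℝ) * (twoStageEst θ d h q.1 q.2 - twoStageEst θ d h y' y'') ≤ t ↔
      bootLin y' y'' (-(√(n : ℝ) / (2 * m * lsSlope h y' y'')) * (1 - bootCorr n θ h y' y'' t))
        (-(√(n : ℝ) / (2 * m * lsSlope h y' y'')) * (1 + bootCorr n θ h y' y'' t)) q ≤ t := by
  have hm' : (0 : ℝ) < m := by exact_mod_cast Nat.pos_of_ne_zero hm
  have hs : 0 < √(n : ℝ) := Real.sqrt_pos.2 (by exact_mod_cast Nat.pos_of_ne_zero hn)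
  rw [twoStageEst_eq _ _ hβ.ne', twoStageEst_eq _ _ hq.ne']
  have e1 := sampleMean_eq_add hm q.1 (sampleMean y')
  have e2 := sampleMean_eq_add hm q.2 (sampleMean y'')
  have e3 := lsSlope_eq (h := h) hm q.1 q.2
  have e4 := lsSlope_eq (h := h) hm y' y''
  rw [e1, e2] at e3
  rw [e1, e2]
  unfold bootLin bootCorr
  generalize ∑ i, (q.1 i - sampleMean y') = S at *
  generalize ∑ i, (q.2 i - sampleMean y'') = T at *
  generalize lsSlope h q.1 q.2 = b' at *
  generalize lsSlope h y' y'' = b at *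
  generalize sampleMean y' = u at *
  generalize sampleMean y'' = v at *
  generalize √(n : ℝ) = s at *
  have hb' : b' = b + (T - S) / (2 * h * m) := by
    rw [e3, e4]; field_simp; ring
  set A := θ - (u + (m : ℝ)⁻¹ * S + (v + (m : ℝ)⁻¹ * T)) / 2 with hA
  set B := θ - (u + v) / 2 with hB
  have hAB : A = B - (S + T) / (2 * m) := by
    rw [hA, hB]; field_simp; ring
  -- Both differences have the same numerator, over the positive denominators b' and b, so they have
  -- the same sign.
  have k1 : s * (A / b' + d - (B / b + d)) - t = (s * A - b' * (t + s * B / b)) / b' := by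
    field_simp; ring
  have k2 : (-(s / (2 * m * b)) * (1 - (t / (s * h) + B / h / b))) * S
      + (-(s / (2 * m * b)) * (1 + (t / (s * h) + B / h / b))) * T - t
      = (s * A - b' * (t + s * B / b)) / b := by
    rw [hAB, hb']; field_simp; ring
  rw [← sub_nonpos, k1, ← sub_nonpos (b := t), k2, div_le_iff₀ hq,
    div_le_iff₀ hβ, zero_mul, zero_mul]

/-- The statistic equals b'/b - 1, the relative error of the resampled slope b'. -/
theorem bootLin_le_neg_one_of_lsSlope_nonpos {m : ℕ} (hm : m ≠ 0) {h : ℝ} (hh : 0 < h)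
    (y' y'' : Fin m → ℝ) (q : (Fin m → ℝ) × (Fin m → ℝ))
    (hβ : 0 < lsSlope h y' y'') (hq : lsSlope h q.1 q.2 ≤ 0) :
    bootLin y' y'' (-(1 / (2 * h * m * lsSlope h y' y''))) (1 / (2 * h * m * lsSlope h y' y'')) q
      ≤ -1 := by
  have hm' : (0 : ℝ) < m := by exact_mod_cast Nat.pos_of_ne_zero hm
  have e1 := sampleMean_eq_add hm q.1 (sampleMean y')
  have e2 := sampleMean_eq_add hm q.2 (sampleMean y'')
  have e3 := lsSlope_eq (h := h) hm q.1 q.2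
  have e4 := lsSlope_eq (h := h) hm y' y''
  rw [e1, e2] at e3
  unfold bootLin
  generalize ∑ i, (q.1 i - sampleMean y') = S at *
  generalize ∑ i, (q.2 i - sampleMean y'') = T at *
  generalize lsSlope h q.1 q.2 = b' at *
  generalize lsSlope h y' y'' = b at *
  generalize sampleMean y' = u at *
  generalize sampleMean y'' = v at *
  have hb' : b' = b + (T - S) / (2 * h * m) := by
    rw [e3, e4]; field_simp; ring
  have k : -(1 / (2 * h * m * b)) * S + 1 / (2 * h * m * b) * T - -1 = b' / b := by
    rw [hb']; field_simp; ring
  have := div_nonpos_of_nonpos_of_nonneg hq hβ.le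
  linarith

/-- The bootstrap event and the half-plane of `sqrt_mul_twoStageEst_sub_le_iff` differ only where
the resampled slope is nonpositive. That event has vanishing probability and also absorbs the
default value of division by a zero slope. -/
theorem tendsto_bootstrapCDF {m n : ℕ → ℕ} (hm : Tendsto m atTop atTop)
    (hn : ∀ᶠ k in atTop, n k ≠ 0)
    (y' y'' : (k : ℕ) → Fin (m k) → ℝ) (d h : ℕ → ℝ) {θ R β V C : ℝ}
    (hβ : 0 < β) (hV0 : 0 < V) (hR0 : 0 < R)
    (hR : Tendsto (fun k => (n k : ℝ) / m k) atTop (𝓝 R))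
    (hh : ∀ᶠ k in atTop, 0 < h k)
    (hnh : Tendsto (fun k => √(n k : ℝ) * h k) atTop atTop)
    (hslope : Tendsto (fun k => lsSlope (h k) (y' k) (y'' k)) atTop (𝓝 β))
    (hbias : Tendsto (fun k => (θ - (sampleMean (y' k) + sampleMean (y'' k)) / 2) / h k)
      atTop (𝓝 0))
    (hV : Tendsto (fun k => sampleVar (y' k)) atTop (𝓝 V))
    (hV' : Tendsto (fun k => sampleVar (y'' k)) atTop (𝓝 V))
    (hC : ∀ᶠ k in atTop, sampleThird (y' k) ≤ C)
    (hC' : ∀ᶠ k in atTop, sampleThird (y'' k) ≤ C) (t : ℝ) :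
    Tendsto (fun k => bootstrapCDF (n k) θ (d k) (h k) (y' k) (y'' k) t) atTop
      (𝓝 ((gaussianReal 0 (R / (2 * β ^ 2) * V).toNNReal).real (Set.Iic t))) := by
  have hm0 : ∀ᶠ k in atTop, m k ≠ 0 := hm.eventually_ne_atTop 0
  have hβk : ∀ᶠ k in atTop, 0 < lsSlope (h k) (y' k) (y'' k) := hslope.eventually_const_lt hβ
  have hcorr : Tendsto (fun k => bootCorr (n k) θ (h k) (y' k) (y'' k) t) atTop (𝓝 0) := by
    have h1 : Tendsto (fun k => t / (√(n k : ℝ) * h k)) atTop (𝓝 0) :=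
      hnh.const_div_atTop t
    have h2 := hbias.div hslope hβ.ne'
    have h3 := h1.add h2
    rw [zero_div, add_zero] at h3
    exact h3
  have hw : Tendsto (fun k => (√(n k : ℝ) / (2 * m k * lsSlope (h k) (y' k) (y'' k))) ^ 2 * m k)
      atTop (𝓝 (R / (4 * β ^ 2))) := by
    have h1 := hR.div ((hslope.pow 2).const_mul 4) (by positivity)
    refine h1.congr' ?_
    filter_upwards [hm0, hβk] with k hk hb
    have : (m k : ℝ) ≠ 0 := by exact_mod_cast hk
    simp only [Pi.div_apply]
    rw [div_pow, Real.sq_sqrt (Nat.cast_nonneg _)]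
    field_simp
    ring
  have hmain : Tendsto (fun k => (bootstrapMeasure (y' k) (y'' k)).real
      {q | bootLin (y' k) (y'' k)
        (-(√(n k : ℝ) / (2 * m k * lsSlope (h k) (y' k) (y'' k)))
          * (1 - bootCorr (n k) θ (h k) (y' k) (y'' k) t))
        (-(√(n k : ℝ) / (2 * m k * lsSlope (h k) (y' k) (y'' k)))
          * (1 + bootCorr (n k) θ (h k) (y' k) (y'' k) t)) q ≤ t}) atTop
      (𝓝 ((gaussianReal 0 (R / (2 * β ^ 2) * V).toNNReal).real (Set.Iic t))) := by
    have hsum : R / (2 * β ^ 2) = R / (4 * β ^ 2) + R / (4 * β ^ 2) := by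
      field_simp; ring
    rw [hsum]
    refine tendsto_real_bootLin_le hm y' y'' _ _ (by positivity) (by positivity) hV0.le
      ?_ ?_ hV hV' hC hC' ?_
    · have := hw.mul ((hcorr.const_sub 1).pow 2)
      simp only [sub_zero, one_pow, mul_one] at this
      exact this.congr fun k => by ring
    · have := hw.mul ((hcorr.const_add 1).pow 2)
      simp only [add_zero, one_pow, mul_one] at this
      exact this.congr fun k => by ring
    · have : ((R / (4 * β ^ 2) + R / (4 * β ^ 2)) * V).toNNReal ≠ 0 := by
        simp only [ne_eq, Real.toNNReal_eq_zero, not_le]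
        positivity
      have := nullSingletonClass_gaussianReal (μ := 0) this
      exact measure_singleton t
  have hneg : Tendsto (fun k => (bootstrapMeasure (y' k) (y'' k)).real
      {q | bootLin (y' k) (y'' k) (-(1 / (2 * h k * m k * lsSlope (h k) (y' k) (y'' k))))
        (1 / (2 * h k * m k * lsSlope (h k) (y' k) (y'' k))) q ≤ -1}) atTop (𝓝 0) := by
    -- These weights are the main ones divided by √n h, which tends to infinity, so the limit law is
    -- the point mass at 0.
    have hw' : Tendsto (fun k => (1 / (2 * h k * m k * lsSlope (h k) (y' k) (y'' k))) ^ 2 * m k)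
        atTop (𝓝 0) := by
      have h1 := hw.mul ((tendsto_inv_atTop_zero.comp hnh).pow 2)
      rw [zero_pow two_ne_zero, mul_zero] at h1
      refine h1.congr' ?_
      filter_upwards [hm0, hβk, hn, hh] with k hk hb hnk hhk
      have h2 : (m k : ℝ) ≠ 0 := by exact_mod_cast hk
      have h3 : √(n k : ℝ) ≠ 0 :=
        (Real.sqrt_pos.2 (by exact_mod_cast Nat.pos_of_ne_zero hnk)).ne'
      simp only [Function.comp]
      field_simp
    have h1 := tendsto_real_bootLin_le hm (x := -1) (y' := y') (y'' := y'')
      (τ := 0) (τ' := 0) (V := V) (C := C)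
      (c' := fun k => 1 / (2 * h k * m k * lsSlope (h k) (y' k) (y'' k))) le_rfl le_rfl hV0.le
      (c := fun k => -(1 / (2 * h k * m k * lsSlope (h k) (y' k) (y'' k))))
      (by simpa only [neg_sq] using hw') hw' hV hV' hC hC' (by simp)
    have h2 : (gaussianReal 0 ((0 + 0) * V).toNNReal).real (Set.Iic (-1)) = 0 := by
      simp [measureReal_def, Measure.dirac_apply' _ measurableSet_Iic]
    rwa [h2] at h1
  rw [tendsto_iff_norm_sub_tendsto_zero] at hmain ⊢
  have hb := hneg.add hmain
  rw [add_zero] at hb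
  refine squeeze_zero' (.of_forall fun _ => norm_nonneg _) ?_ hb
  filter_upwards [hm0, hβk, hn, hh] with k hk hbk hnk hhk
  have := isProbabilityMeasure_bootstrapMeasure hk (y' k) (y'' k)
  refine (norm_sub_le_norm_sub_add_norm_sub _ _ _).trans (add_le_add ?_ le_rfl)
  rw [bootstrapCDF, Real.norm_eq_abs, abs_sub_le_iff]
  constructor
  · rw [tsub_le_iff_right]
    refine (measureReal_mono fun q hq => ?_).trans (measureReal_union_le _ _)
    rcases le_or_gt (lsSlope (h k) q.1 q.2) 0 with hle | hgt
    · exact Or.inl (bootLin_le_neg_one_of_lsSlope_nonpos hk hhk _ _ _ hbk hle)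
    · exact Or.inr ((sqrt_mul_twoStageEst_sub_le_iff hk hnk hhk _ _ q hbk hgt).1 hq)
  · rw [tsub_le_iff_right]
    refine (measureReal_mono fun q hq => ?_).trans (measureReal_union_le _ _)
    rcases le_or_gt (lsSlope (h k) q.1 q.2) 0 with hle | hgt
    · exact Or.inl (bootLin_le_neg_one_of_lsSlope_nonpos hk hhk _ _ _ hbk hle)
    · exact Or.inr ((sqrt_mul_twoStageEst_sub_le_iff hk hnk hhk _ _ q hbk hgt).2 hq)

theorem continuous_cdf (μ : Measure ℝ) [IsProbabilityMeasure μ] [NullSingletonClass μ] :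
    Continuous (cdf μ) := by
  refine continuous_iff_continuousAt.2 fun a => ?_
  rw [(monotone_cdf μ).continuousAt_iff_leftLim_eq_rightLim, StieltjesFunction.rightLim_eq]
  refine le_antisymm ((monotone_cdf μ).leftLim_le le_rfl) ?_
  have h := StieltjesFunction.measure_singleton (cdf μ) a
  rw [measure_cdf, measure_singleton, eq_comm, ENNReal.ofReal_eq_zero] at h
  linarith

theorem tendsto_iSup_bootstrapCDF_sub {m n : ℕ → ℕ} (hm : Tendsto m atTop atTop)
    (hn : ∀ᶠ k in atTop, n k ≠ 0)
    (y' y'' : (k : ℕ) → Fin (m k) → ℝ) (d h : ℕ → ℝ) {θ R β V C : ℝ}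
    (hβ : 0 < β) (hV0 : 0 < V) (hR0 : 0 < R)
    (hR : Tendsto (fun k => (n k : ℝ) / m k) atTop (𝓝 R))
    (hh : ∀ᶠ k in atTop, 0 < h k)
    (hnh : Tendsto (fun k => √(n k : ℝ) * h k) atTop atTop)
    (hslope : Tendsto (fun k => lsSlope (h k) (y' k) (y'' k)) atTop (𝓝 β))
    (hbias : Tendsto (fun k => (θ - (sampleMean (y' k) + sampleMean (y'' k)) / 2) / h k)
      atTop (𝓝 0))
    (hV : Tendsto (fun k => sampleVar (y' k)) atTop (𝓝 V))
    (hV' : Tendsto (fun k => sampleVar (y'' k)) atTop (𝓝 V))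
    (hC : ∀ᶠ k in atTop, sampleThird (y' k) ≤ C)
    (hC' : ∀ᶠ k in atTop, sampleThird (y'' k) ≤ C) :
    Tendsto (fun k => ⨆ t, |bootstrapCDF (n k) θ (d k) (h k) (y' k) (y'' k) t
      - (gaussianReal 0 (R / (2 * β ^ 2) * V).toNNReal).real (Set.Iic t)|) atTop (𝓝 0) := by
  have hne : (R / (2 * β ^ 2) * V).toNNReal ≠ 0 := by
    simp only [ne_eq, Real.toNNReal_eq_zero, not_le]
    positivity
  have hatom := nullSingletonClass_gaussianReal (μ := 0) hne
  have hcdf : (fun t => (gaussianReal 0 (R / (2 * β ^ 2) * V).toNNReal).real (Set.Iic t))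
      = cdf (gaussianReal 0 (R / (2 * β ^ 2) * V).toNNReal) := by
    ext t; rw [cdf_eq_real]
  refine tendstoUniformly_of_monotone_of_tendsto ?_ ?_ ?_ ?_ ?_
    (tendsto_bootstrapCDF hm hn y' y'' d h hβ hV0 hR0 hR hh hnh hslope hbias hV hV' hC hC')
  · filter_upwards [hm.eventually_ne_atTop 0] with k hk
    have := isProbabilityMeasure_bootstrapMeasure hk (y' k) (y'' k)
    refine ⟨fun s t hst => measureReal_mono fun q hq => ?_, fun t =>
      ⟨measureReal_nonneg, measureReal_le_one⟩⟩
    exact le_trans hq hst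
  · rw [hcdf]; exact continuous_cdf _
  · rw [hcdf]; exact monotone_cdf _
  · rw [hcdf]; exact tendsto_cdf_atBot _
  · rw [hcdf]; exact tendsto_cdf_atTop _

/-! ### A Hájek–Rényi inequality for averages of independent variables -/

/-- The indices below `k`. -/
abbrev indicesBelow (M k : ℕ) : Finset (Fin M) := Finset.univ.filter fun i => (i : ℕ) < k

/-- Partial sum of the first `k` members of a finite family. -/
noncomputable def partialSum {Ω : Type*} {M : ℕ} (ξ : Fin M → Ω → ℝ) (k : ℕ) (ω : Ω) : ℝ :=
  ∑ i ∈ indicesBelow M k, ξ i ω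

/-- The first `k` members of a finite family. -/
def initialVars {Ω : Type*} {M : ℕ} (ξ : Fin M → Ω → ℝ) (k : ℕ) (ω : Ω) :
    indicesBelow M k → ℝ := fun i => ξ i.1 ω

/-- The partial sum up to `j` as a function of the first `k` values. -/
noncomputable def initialSum {M k : ℕ} (j : ℕ) (u : indicesBelow M k → ℝ) : ℝ :=
  ∑ i, if (i.1 : ℕ) < j then u i else 0

/-- The event that some average of at least `N` and at most `k` initial terms reaches `r`. -/
def exceedance {Ω : Type*} {M : ℕ} (ξ : Fin M → Ω → ℝ) (N : ℕ) (r : ℝ) (k : ℕ) : Set Ω :=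
  {ω | ∃ j, N ≤ j ∧ j ≤ k ∧ r * j ≤ |partialSum ξ j ω|}

/-- The weighted sum of squares that dominates the exceedance event. -/
noncomputable def weightedSq {Ω : Type*} {M : ℕ} (ξ : Fin M → Ω → ℝ) (N k : ℕ) (ω : Ω) : ℝ :=
  ∑ j ∈ Finset.Ico N k, (1 / (j : ℝ) ^ 2 - 1 / ((j : ℝ) + 1) ^ 2) * partialSum ξ j ω ^ 2
    + partialSum ξ k ω ^ 2 / (k : ℝ) ^ 2

section HajekRenyi

variable {Ω : Type*} {M : ℕ} {ξ : Fin M → Ω → ℝ}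

theorem partialSum_succ {k : ℕ} (hk : k < M) (ω : Ω) :
    partialSum ξ (k + 1) ω = partialSum ξ k ω + ξ ⟨k, hk⟩ ω := by
  have : indicesBelow M (k + 1) = insert ⟨k, hk⟩ (indicesBelow M k) := by
    ext i
    simp [indicesBelow, Fin.ext_iff]
    omega
  rw [partialSum, this, Finset.sum_insert (by simp), add_comm]
  rfl

theorem initialSum_initialVars {j k : ℕ} (hjk : j ≤ k) (ω : Ω) :
    initialSum j (initialVars ξ k ω) = partialSum ξ j ω := by
  simp only [initialVars, initialSum]
  rw [partialSum, Finset.sum_coe_sort (indicesBelow M k)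
      (fun i => if (i : ℕ) < j then ξ i ω else 0), Finset.sum_filter, Finset.sum_filter]
  refine Finset.sum_congr rfl fun i _ => ?_
  split_ifs with h1 h2 <;> first | rfl | omega

theorem measurable_initialSum {k : ℕ} (j : ℕ) :
    Measurable (initialSum j : (indicesBelow M k → ℝ) → ℝ) := by
  unfold initialSum
  refine Finset.measurable_sum _ fun i _ => ?_
  split_ifs <;> fun_prop

/-- The exceedance event up to time `k` depends on the first `k` variables only; this plays the role
of adaptedness. -/
theorem exceedance_eq_preimage (ξ : Fin M → Ω → ℝ) (N : ℕ) (r : ℝ) (k : ℕ) :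
    ∃ A : Set (indicesBelow M k → ℝ), MeasurableSet A ∧
      exceedance ξ N r k = initialVars ξ k ⁻¹' A := by
  refine ⟨⋃ j ∈ Finset.Icc N k, {u | r * j ≤ |initialSum j u|}, ?_, ?_⟩
  · refine Finset.measurableSet_biUnion _ fun j _ => ?_
    exact measurableSet_le measurable_const (measurable_initialSum j).abs
  · ext ω
    simp only [exceedance, Set.mem_ofPred_eq, Set.mem_preimage, Set.mem_iUnion, Finset.mem_Icc]
    constructor
    · rintro ⟨j, h1, h2, h3⟩
      refine ⟨j, ⟨h1, h2⟩, ?_⟩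
      rw [← initialSum_initialVars h2] at h3
      exact h3
    · rintro ⟨j, ⟨h1, h2⟩, h3⟩
      refine ⟨j, h1, h2, ?_⟩
      rw [← initialSum_initialVars h2]
      exact h3

/-- Summation by parts: `weightedSq` accumulates the increments of the squared partial sums with
decreasing weights 1/(k+1)². On past events these increments have nonnegative integral. -/
theorem weightedSq_succ {N k : ℕ} (hN : 0 < N) (hk : N ≤ k) (ω : Ω) :
    weightedSq ξ N (k + 1) ω = weightedSq ξ N k ω
      + (partialSum ξ (k + 1) ω ^ 2 - partialSum ξ k ω ^ 2) / ((k : ℝ) + 1) ^ 2 := by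
  have : (k : ℝ) ≠ 0 := by
    have : 0 < k := hN.trans_le hk
    positivity
  unfold weightedSq
  rw [Finset.sum_Ico_succ_top hk]
  push_cast
  field_simp
  ring

theorem sq_div_sq_le_weightedSq (ξ : Fin M → Ω → ℝ) {N : ℕ} (hN : 0 < N) (k : ℕ) (ω : Ω) :
    partialSum ξ k ω ^ 2 / (k : ℝ) ^ 2 ≤ weightedSq ξ N k ω := by
  unfold weightedSq
  refine le_add_of_nonneg_left (Finset.sum_nonneg fun j hj => mul_nonneg ?_ (sq_nonneg _))
  have : 0 < j := hN.trans_le (Finset.mem_Ico.1 hj).1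
  rw [sub_nonneg]
  gcongr
  linarith

variable [MeasurableSpace Ω] {P : Measure Ω}

theorem memLp_partialSum (hξ2 : ∀ i, MemLp (ξ i) 2 P) (k : ℕ) :
    MemLp (partialSum ξ k) 2 P := by
  unfold partialSum
  exact memLp_finsetSum _ fun i _ => hξ2 i

theorem measurable_initialVars (hξ : ∀ i, Measurable (ξ i)) (k : ℕ) :
    Measurable (initialVars ξ k) :=
  measurable_pi_lambda _ fun i => hξ i.1

/-- The martingale property in elementary form: the partial sum cut off to a past event is a
function of the first `k` variables, hence independent of the next, centred one. -/
theorem setIntegral_partialSum_mul_eq_zero (hξ : ∀ i, Measurable (ξ i))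
    (hind : iIndepFun ξ P) (h0 : ∀ i, ∫ ω, ξ i ω ∂P = 0) {k : ℕ} (hk : k < M)
    {A : Set (indicesBelow M k → ℝ)} (hA : MeasurableSet A) :
    ∫ ω in initialVars ξ k ⁻¹' A, partialSum ξ k ω * ξ ⟨k, hk⟩ ω ∂P = 0 := by
  have hpast := measurable_initialVars hξ k
  have h1 : IndepFun (initialVars ξ k) _ P := hind.indepFun_finset (indicesBelow M k) {⟨k, hk⟩}
    (by simp) hξ
  let φ : (indicesBelow M k → ℝ) → ℝ :=
    A.indicator (initialSum k)
  have hφ : Measurable φ := (measurable_initialSum k).indicator hA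
  have h2 := h1.comp hφ (measurable_pi_apply (⟨⟨k, hk⟩, by simp⟩ : ({⟨k, hk⟩} : Finset (Fin M))))
  have h3 := h2.integral_fun_mul_eq_mul_integral (hφ.comp hpast).aestronglyMeasurable
    (hξ ⟨k, hk⟩).aestronglyMeasurable
  rw [← integral_indicator (hpast hA)]
  have hφdef : φ = A.indicator (initialSum k) := rfl
  have h4 : ∀ ω, (initialVars ξ k ⁻¹' A).indicator (fun ω => partialSum ξ k ω * ξ ⟨k, hk⟩ ω) ω
      = φ (initialVars ξ k ω) * ξ ⟨k, hk⟩ ω := by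
    intro ω
    by_cases hω : initialVars ξ k ω ∈ A
    · rw [Set.indicator_of_mem (Set.mem_preimage.2 hω), hφdef, Set.indicator_of_mem hω,
        initialSum_initialVars le_rfl]
    · rw [Set.indicator_of_notMem (mt Set.mem_preimage.1 hω), hφdef, Set.indicator_of_notMem hω,
        zero_mul]
  simp only [h4]
  refine h3.trans ?_
  simp only [Function.comp_def, h0, mul_zero]

theorem integral_sq_partialSum (hξ : ∀ i, Measurable (ξ i)) (hξ2 : ∀ i, MemLp (ξ i) 2 P)
    (hind : iIndepFun ξ P) (h0 : ∀ i, ∫ ω, ξ i ω ∂P = 0) {v : ℝ}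
    (hv : ∀ i, ∫ ω, ξ i ω ^ 2 ∂P = v) {k : ℕ} (hk : k ≤ M) :
    ∫ ω, partialSum ξ k ω ^ 2 ∂P = k * v := by
  induction k with
  | zero => simp [partialSum, indicesBelow]
  | succ k ih =>
    have hk' : k < M := hk
    have h1 := setIntegral_partialSum_mul_eq_zero hξ hind h0 hk' MeasurableSet.univ
    rw [Set.preimage_univ, setIntegral_univ] at h1
    simp only [partialSum_succ hk', add_sq]
    have i1 := (memLp_partialSum hξ2 k).integrable_sq
    have i2 := (hξ2 ⟨k, hk'⟩).integrable_sq
    have i3 := (memLp_partialSum hξ2 k).integrable_mul (hξ2 ⟨k, hk'⟩)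
    have i4 : Integrable (fun ω => 2 * partialSum ξ k ω * ξ ⟨k, hk'⟩ ω) P := by
      refine (i3.const_mul 2).congr (.of_forall fun ω => ?_)
      simp only [Pi.mul_apply]; ring
    have i5 : Integrable (fun ω => partialSum ξ k ω ^ 2 + 2 * partialSum ξ k ω * ξ ⟨k, hk'⟩ ω) P :=
      i1.add i4
    rw [integral_add i5 i2, integral_add i1 i4, ih hk'.le, hv]
    simp only [mul_assoc]
    rw [integral_const_mul, h1]
    push_cast; ring

theorem setIntegral_sq_partialSum_le (hξ : ∀ i, Measurable (ξ i)) (hξ2 : ∀ i, MemLp (ξ i) 2 P)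
    (hind : iIndepFun ξ P) (h0 : ∀ i, ∫ ω, ξ i ω ∂P = 0) {k : ℕ} (hk : k < M)
    {A : Set (indicesBelow M k → ℝ)} (hA : MeasurableSet A) :
    ∫ ω in initialVars ξ k ⁻¹' A, partialSum ξ k ω ^ 2 ∂P
      ≤ ∫ ω in initialVars ξ k ⁻¹' A, partialSum ξ (k + 1) ω ^ 2 ∂P := by
  have h1 := setIntegral_partialSum_mul_eq_zero hξ hind h0 hk hA
  simp only [partialSum_succ hk, add_sq]
  have i1 := (memLp_partialSum hξ2 k).integrable_sq
  have i2 := (hξ2 ⟨k, hk⟩).integrable_sq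
  have i3 := (memLp_partialSum hξ2 k).integrable_mul (hξ2 ⟨k, hk⟩)
  have i4 : Integrable (fun ω => 2 * partialSum ξ k ω * ξ ⟨k, hk⟩ ω) P := by
    refine (i3.const_mul 2).congr (.of_forall fun ω => ?_)
    simp only [Pi.mul_apply]; ring
  have i5 : Integrable (fun ω => partialSum ξ k ω ^ 2 + 2 * partialSum ξ k ω * ξ ⟨k, hk⟩ ω) P :=
    i1.add i4
  rw [integral_add i5.integrableOn i2.integrableOn,
    integral_add i1.integrableOn i4.integrableOn]
  simp only [mul_assoc]
  rw [integral_const_mul, h1, mul_zero, add_zero]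
  have : 0 ≤ ∫ ω in initialVars ξ k ⁻¹' A, ξ ⟨k, hk⟩ ω ^ 2 ∂P :=
    integral_nonneg fun ω => sq_nonneg _
  linarith

theorem measurableSet_exceedance (hξ : ∀ i, Measurable (ξ i)) (N : ℕ) (r : ℝ) (k : ℕ) :
    MeasurableSet (exceedance ξ N r k) := by
  obtain ⟨A, hA, h⟩ := exceedance_eq_preimage ξ N r k
  rw [h]
  exact measurable_initialVars hξ k hA

theorem integrable_weightedSq (hξ2 : ∀ i, MemLp (ξ i) 2 P) (N k : ℕ) :
    Integrable (weightedSq ξ N k) P := by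
  unfold weightedSq
  refine Integrable.add (integrable_finsetSum _ fun j _ => ?_) ?_
  · exact (memLp_partialSum hξ2 j).integrable_sq.const_mul _
  · exact (memLp_partialSum hξ2 k).integrable_sq.div_const _

/-- The start contributes v/N = v (2/N - 1/N), and each increment v/(k+1)² is at most v (1/k -
1/(k+1)), so the bound telescopes. -/
theorem integral_weightedSq_le (hξ : ∀ i, Measurable (ξ i)) (hξ2 : ∀ i, MemLp (ξ i) 2 P)
    (hind : iIndepFun ξ P) (h0 : ∀ i, ∫ ω, ξ i ω ∂P = 0) {v : ℝ} (hv0 : 0 ≤ v)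
    (hv : ∀ i, ∫ ω, ξ i ω ^ 2 ∂P = v) {N : ℕ} (hN : 0 < N) {k : ℕ} (hNk : N ≤ k) (hk : k ≤ M) :
    ∫ ω, weightedSq ξ N k ω ∂P ≤ v * (2 / N - 1 / k) := by
  induction k, hNk using Nat.le_induction with
  | base =>
    have hN' : (0 : ℝ) < N := by exact_mod_cast hN
    simp only [weightedSq, Finset.Ico_self, Finset.sum_empty, zero_add]
    rw [integral_div, integral_sq_partialSum hξ hξ2 hind h0 hv hk]
    apply le_of_eq
    field_simp
    ring
  | succ k hNk ih =>
    have ih := ih (by omega)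
    have hk' : (0 : ℝ) < k := by exact_mod_cast hN.trans_le hNk
    simp only [weightedSq_succ hN hNk]
    have hi : Integrable (fun ω => (partialSum ξ (k + 1) ω ^ 2 - partialSum ξ k ω ^ 2)
        / ((k : ℝ) + 1) ^ 2) P :=
      ((memLp_partialSum hξ2 _).integrable_sq.sub
        (memLp_partialSum hξ2 _).integrable_sq).div_const _
    rw [integral_add (integrable_weightedSq hξ2 N k) hi, integral_div,
      integral_sub (memLp_partialSum hξ2 _).integrable_sq
        (memLp_partialSum hξ2 _).integrable_sq,
      integral_sq_partialSum hξ hξ2 hind h0 hv hk,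
      integral_sq_partialSum hξ hξ2 hind h0 hv (by omega)]
    have h1 : (((k + 1 : ℕ) : ℝ) * v - k * v) / ((k : ℝ) + 1) ^ 2 ≤ v * (1 / k - 1 / (k + 1)) := by
      have : (((k + 1 : ℕ) : ℝ) * v - k * v) / ((k : ℝ) + 1) ^ 2 = v * (1 / ((k : ℝ) + 1) ^ 2) := by
        push_cast; ring
      rw [this]
      refine mul_le_mul_of_nonneg_left ?_ hv0
      rw [div_sub_div _ _ hk'.ne' (by positivity), div_le_div_iff₀ (by positivity) (by positivity)]
      nlinarith
    push_cast
    push_cast at h1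
    linarith

variable [IsProbabilityMeasure P]

/-- Induction on the horizon replaces a stopping time. On the old event the integral of `weightedSq`
can only grow; on the new part the average at time k + 1 itself is large. -/
theorem sq_mul_real_exceedance_le (hξ : ∀ i, Measurable (ξ i)) (hξ2 : ∀ i, MemLp (ξ i) 2 P)
    (hind : iIndepFun ξ P) (h0 : ∀ i, ∫ ω, ξ i ω ∂P = 0) {N : ℕ} (hN : 0 < N) {r : ℝ}
    (hr : 0 < r) {k : ℕ} (hNk : N ≤ k) (hk : k ≤ M) :
    r ^ 2 * P.real (exceedance ξ N r k) ≤ ∫ ω in exceedance ξ N r k, weightedSq ξ N k ω ∂P := by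
  have hconst : ∀ (B : Set Ω) (j : ℕ), 0 < j → MeasurableSet B →
      (∀ ω ∈ B, r * j ≤ |partialSum ξ j ω|) →
      r ^ 2 * P.real B ≤ ∫ ω in B, weightedSq ξ N j ω ∂P := by
    intro B j hj hB h
    have h1 : ∫ ω in B, r ^ 2 ∂P = r ^ 2 * P.real B := by
      rw [setIntegral_const, smul_eq_mul, mul_comm]
    rw [← h1]
    refine setIntegral_mono_on (integrable_const _).integrableOn
      (integrable_weightedSq hξ2 N j).integrableOn hB fun ω hω => ?_
    refine le_trans ?_ (sq_div_sq_le_weightedSq ξ hN j ω)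
    have hj' : (0 : ℝ) < j := by exact_mod_cast hj
    rw [le_div_iff₀ (by positivity), ← mul_pow, ← sq_abs (partialSum ξ j ω)]
    exact pow_le_pow_left₀ (by positivity) (h ω hω) 2
  induction k, hNk using Nat.le_induction with
  | base =>
    refine hconst _ N hN (measurableSet_exceedance hξ _ _ _) ?_
    rintro ω ⟨j, h1, h2, h3⟩
    obtain rfl : j = N := le_antisymm h2 h1
    exact h3
  | succ k hNk ih =>
    have ih := ih (by omega)
    have hk' : k < M := hk
    obtain ⟨A, hA, hAeq⟩ := exceedance_eq_preimage ξ N r k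
    have hsub : exceedance ξ N r k ⊆ exceedance ξ N r (k + 1) := by
      rintro ω ⟨j, h1, h2, h3⟩
      exact ⟨j, h1, by omega, h3⟩
    have hm1 := measurableSet_exceedance hξ N r k
    have hm2 := measurableSet_exceedance hξ N r (k + 1)
    have hstep : ∫ ω in exceedance ξ N r k, weightedSq ξ N k ω ∂P
        ≤ ∫ ω in exceedance ξ N r k, weightedSq ξ N (k + 1) ω ∂P := by
      have h1 := setIntegral_sq_partialSum_le hξ hξ2 hind h0 hk' hA
      rw [← hAeq] at h1
      simp only [weightedSq_succ hN hNk]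
      have hi : Integrable (fun ω => (partialSum ξ (k + 1) ω ^ 2 - partialSum ξ k ω ^ 2)
        / ((k : ℝ) + 1) ^ 2) P :=
      ((memLp_partialSum hξ2 _).integrable_sq.sub
        (memLp_partialSum hξ2 _).integrable_sq).div_const _
      rw [integral_add (integrable_weightedSq hξ2 N k).integrableOn hi.integrableOn, integral_div,
        integral_sub (memLp_partialSum hξ2 _).integrable_sq.integrableOn
          (memLp_partialSum hξ2 _).integrable_sq.integrableOn]
      exact le_add_of_nonneg_right (div_nonneg (by linarith) (by positivity))
    have hnew := hconst (exceedance ξ N r (k + 1) \ exceedance ξ N r k) (k + 1) (by omega)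
      (hm2.diff hm1) (by
        rintro ω ⟨⟨j, h1, h2, h3⟩, h4⟩
        rcases Nat.lt_or_ge j (k + 1) with h5 | h5
        · exact absurd ⟨j, h1, by omega, h3⟩ h4
        · obtain rfl : j = k + 1 := le_antisymm h2 h5
          exact h3)
    have e1 : P.real (exceedance ξ N r (k + 1)) = P.real (exceedance ξ N r k)
        + P.real (exceedance ξ N r (k + 1) \ exceedance ξ N r k) := by
      rw [measureReal_sdiff hsub hm1]; ring
    have e2 := setIntegral_sdiff hm1
      (integrable_weightedSq (P := P) hξ2 N (k + 1)).integrableOn hsub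
    rw [e1, mul_add]
    linarith

theorem real_exceedance_le_of_measurable (hξ : ∀ i, Measurable (ξ i))
    (hξ2 : ∀ i, MemLp (ξ i) 2 P) (hind : iIndepFun ξ P) (h0 : ∀ i, ∫ ω, ξ i ω ∂P = 0) {v : ℝ}
    (hv0 : 0 ≤ v) (hv : ∀ i, ∫ ω, ξ i ω ^ 2 ∂P = v) {N : ℕ} (hN : 0 < N) {r : ℝ} (hr : 0 < r) :
    P.real (exceedance ξ N r M) ≤ 2 * v / (N * r ^ 2) := by
  rcases Nat.lt_or_ge M N with hM | hM
  · have : exceedance ξ N r M = ∅ := by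
      ext ω
      simp only [exceedance, Set.mem_ofPred_eq, Set.mem_empty_iff_false, iff_false]
      rintro ⟨j, h1, h2, _⟩
      omega
    rw [this, measureReal_empty]
    positivity
  · have h1 := sq_mul_real_exceedance_le hξ hξ2 hind h0 hN hr hM le_rfl
    have h2 := integral_weightedSq_le hξ hξ2 hind h0 hv0 hv hN hM le_rfl
    have h3 : ∫ ω in exceedance ξ N r M, weightedSq ξ N M ω ∂P ≤ ∫ ω, weightedSq ξ N M ω ∂P :=
      setIntegral_le_integral (integrable_weightedSq hξ2 N M) (.of_forall fun ω =>
        le_trans (by positivity) (sq_div_sq_le_weightedSq ξ hN M ω))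
    have hN' : (0 : ℝ) < N := by exact_mod_cast hN
    rw [le_div_iff₀ (by positivity)]
    have h4 : v * (2 / N - 1 / M) ≤ v * (2 / N) := by
      refine mul_le_mul_of_nonneg_left ?_ hv0
      have : (0 : ℝ) ≤ 1 / M := by positivity
      linarith
    have h5 : r ^ 2 * P.real (exceedance ξ N r M) ≤ v * (2 / N) := by linarith
    calc P.real (exceedance ξ N r M) * (N * r ^ 2)
        = (r ^ 2 * P.real (exceedance ξ N r M)) * N := by ring
      _ ≤ v * (2 / N) * N := by gcongr
      _ = 2 * v := by field_simp

/-- **Hájek–Rényi inequality** for averages of independent centered variables with equal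
variances. -/
theorem real_exceedance_le (hξ2 : ∀ i, MemLp (ξ i) 2 P) (hind : iIndepFun ξ P)
    (h0 : ∀ i, ∫ ω, ξ i ω ∂P = 0) {v : ℝ} (hv0 : 0 ≤ v) (hv : ∀ i, ∫ ω, ξ i ω ^ 2 ∂P = v)
    {N : ℕ} (hN : 0 < N) {r : ℝ} (hr : 0 < r) :
    P.real (exceedance ξ N r M) ≤ 2 * v / (N * r ^ 2) := by
  -- Measurable modifications leave the moments, the independence and, up to a null set, the event
  -- unchanged.
  have hm : ∀ i, AEMeasurable (ξ i) P := fun i => (hξ2 i).aestronglyMeasurable.aemeasurable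
  let η : Fin M → Ω → ℝ := fun i => (hm i).mk
  have hη : ∀ i, ξ i =ᵐ[P] η i := fun i => (hm i).ae_eq_mk
  have hS : ∀ᵐ ω ∂P, ∀ i, ξ i ω = η i ω := ae_all_iff.2 hη
  have hE : P.real (exceedance ξ N r M) = P.real (exceedance η N r M) := by
    refine measureReal_congr ?_
    filter_upwards [hS] with ω hω
    have : ∀ j, partialSum ξ j ω = partialSum η j ω := fun j =>
      Finset.sum_congr rfl fun i _ => hω i
    refine propext ?_
    change (∃ j, _) ↔ (∃ j, _)
    simp only [this]
  rw [hE]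
  refine real_exceedance_le_of_measurable (fun i => (hm i).measurable_mk)
    (fun i => (memLp_congr_ae (hη i)).1 (hξ2 i)) (hind.congr hη) (fun i => ?_) hv0 (fun i => ?_)
    hN hr
  · rw [← h0 i]; exact (integral_congr_ae (hη i)).symm
  · rw [← hv i]
    refine integral_congr_ae ?_
    filter_upwards [hη i] with ω hω
    rw [hω]

end HajekRenyi

/-! ### Blocks of an isotonic regression -/

/-- First-order optimality. An admissible shift by c s on E changes the residual sum of squares by
-2 s A + s² |E| c², with A the left-hand side below; this cannot be negative for small s, so A ≤ 0.
-/
theorem IsIsotonicRegression.sum_mul_le_zero {m : ℕ} {x Y : ℕ → ℝ} {u : ℝ → ℝ}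
    (hu : IsIsotonicRegression m x Y u) {E : Finset ℕ} (hE : E ⊆ Finset.range m) (c : ℝ)
    {δ : ℝ} (hδ : 0 < δ)
    (hpert : ∀ s, 0 < s → s ≤ δ → ∃ h : ℝ → ℝ, MonotoneOn h (Set.Icc 0 1) ∧
      ∀ i < m, h (x i) = u (x i) + if i ∈ E then c * s else 0) :
    c * ∑ i ∈ E, (Y i - u (x i)) ≤ 0 := by
  by_contra! hpos
  set A := c * ∑ i ∈ E, (Y i - u (x i)) with hA
  have hkey : ∀ s, 0 < s → s ≤ δ → 2 * A ≤ s * (E.card * c ^ 2) := by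
    intro s hs hsδ
    obtain ⟨h, hh, hval⟩ := hpert s hs hsδ
    have h1 := hu.2 h hh
    have h2 : ∑ i ∈ Finset.range m, (Y i - h (x i)) ^ 2
        = ∑ i ∈ Finset.range m, (Y i - u (x i)) ^ 2
          - ∑ i ∈ E, (2 * (c * s) * (Y i - u (x i)) - (c * s) ^ 2) := by
      rw [← Finset.inter_eq_right.2 hE, ← Finset.sum_ite_mem, ← Finset.sum_sub_distrib]
      refine Finset.sum_congr rfl fun i hi => ?_
      rw [hval i (Finset.mem_range.1 hi)]
      split_ifs <;> ring
    rw [h2, Finset.sum_sub_distrib, ← Finset.mul_sum, Finset.sum_const, nsmul_eq_mul] at h1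
    have h3 : s * (2 * A) ≤ s * (s * (E.card * c ^ 2)) := by
      rw [hA]; linarith
    exact le_of_mul_le_mul_left h3 hs
  -- With this s the quadratic side is at most A, against 2A. The added 1 keeps the denominator
  -- positive when E is empty or c = 0.
  have h4 := hkey (min δ (A / (E.card * c ^ 2 + 1))) (lt_min hδ (by positivity)) (min_le_left _ _)
  have h5 : min δ (A / (E.card * c ^ 2 + 1)) * (E.card * c ^ 2) ≤ A := by
    calc _ ≤ A / (E.card * c ^ 2 + 1) * (E.card * c ^ 2) := by gcongr; exact min_le_right _ _
      _ ≤ A / (E.card * c ^ 2 + 1) * (E.card * c ^ 2 + 1) := by gcongr; linarith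
      _ = A := by field_simp
  linarith

theorem exists_pos_forall_le_of_finset {E : Finset ℕ} {g : ℕ → ℝ} (h : ∀ i ∈ E, 0 < g i) :
    ∃ δ > 0, ∀ i ∈ E, δ ≤ g i := by
  rcases E.eq_empty_or_nonempty with rfl | hne
  · exact ⟨1, one_pos, by simp⟩
  · obtain ⟨i, hi, hmin⟩ := E.exists_min_image g hne
    exact ⟨g i, h i hi, hmin⟩

/-- The fit may be raised slightly on this block without losing monotonicity: the jump at `a` is
upward, and capping at `θ` prevents overtaking the values to the right. -/
theorem IsIsotonicRegression.sum_sub_nonpos {m : ℕ} {x Y : ℕ → ℝ} {u : ℝ → ℝ}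
    (hu : IsIsotonicRegression m x Y u) (a θ : ℝ) :
    ∑ i ∈ Finset.range m with a < x i ∧ u (x i) < θ, (Y i - u (x i)) ≤ 0 := by
  set E := (Finset.range m).filter fun i => a < x i ∧ u (x i) < θ with hE
  obtain ⟨δ, hδ, hgap⟩ := exists_pos_forall_le_of_finset (E := E) (g := fun i => θ - u (x i))
    (fun i hi => by
      have := (Finset.mem_filter.1 hi).2.2
      linarith)
  rw [← one_mul (∑ i ∈ E, _)]
  -- As δ is at most the smallest gap θ - u(xᵢ) over the block, the cap leaves the full shift s at
  -- every design point of the block.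
  refine hu.sum_mul_le_zero (Finset.filter_subset _ _) 1 hδ fun s hs hsδ =>
    ⟨fun t => if a < t then max (u t) (min (u t + s) θ) else u t, ?_, ?_⟩
  · intro t ht t' ht' htt
    have hm := hu.1 ht ht' htt
    dsimp only
    split_ifs with h1 h2
    · gcongr
    · exact absurd (h1.trans_le htt) h2
    · exact hm.trans (le_max_left _ _)
    · exact hm
  · intro i hi
    dsimp only
    by_cases hiE : i ∈ E
    · have h1 := (Finset.mem_filter.1 hiE).2
      have h2 := hgap i hiE
      rw [if_pos h1.1, if_pos hiE, min_eq_left (by linarith), max_eq_right (by linarith), one_mul]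
    · rw [if_neg hiE, add_zero]
      split_ifs with h1
      · have : ¬ u (x i) < θ := fun h => hiE (Finset.mem_filter.2 ⟨Finset.mem_range.2 hi, h1, h⟩)
        exact max_eq_left ((min_le_right _ _).trans (not_lt.1 this))
      · rfl

/-- Mirror image: the fit is lowered to the left of `b`, with `θ` as floor. -/
theorem IsIsotonicRegression.sum_sub_nonneg {m : ℕ} {x Y : ℕ → ℝ} {u : ℝ → ℝ}
    (hu : IsIsotonicRegression m x Y u) (b θ : ℝ) :
    0 ≤ ∑ i ∈ Finset.range m with x i ≤ b ∧ θ < u (x i), (Y i - u (x i)) := by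
  set E := (Finset.range m).filter fun i => x i ≤ b ∧ θ < u (x i) with hE
  obtain ⟨δ, hδ, hgap⟩ := exists_pos_forall_le_of_finset (E := E) (g := fun i => u (x i) - θ)
    (fun i hi => by
      have := (Finset.mem_filter.1 hi).2.2
      linarith)
  rw [← neg_nonpos, neg_eq_neg_one_mul]
  refine hu.sum_mul_le_zero (Finset.filter_subset _ _) (-1) hδ fun s hs hsδ =>
    ⟨fun t => if t ≤ b then min (u t) (max (u t - s) θ) else u t, ?_, ?_⟩
  · intro t ht t' ht' htt
    have hm := hu.1 ht ht' htt
    dsimp only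
    split_ifs with h1 h2
    · gcongr
    · exact (min_le_left _ _).trans hm
    · exact absurd (htt.trans ‹_›) h1
    · exact hm
  · intro i hi
    dsimp only
    by_cases hiE : i ∈ E
    · have h1 := (Finset.mem_filter.1 hiE).2
      have h2 := hgap i hiE
      rw [if_pos h1.1, if_pos hiE, max_eq_left (by linarith), min_eq_right (by linarith)]
      ring
    · rw [if_neg hiE, add_zero]
      split_ifs with h1
      · have : ¬ θ < u (x i) := fun h => hiE (Finset.mem_filter.2 ⟨Finset.mem_range.2 hi, h1, h⟩)
        exact min_eq_left ((not_lt.1 this).trans (le_max_right _ _))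
      · rfl

/-! ### Design counts, and blocks with a large noise average -/

theorem eq_range_card_of_forall_le_mem {s : Finset ℕ} (h : ∀ i ∈ s, ∀ j ≤ i, j ∈ s) :
    s = Finset.range s.card := by
  have hsub : ∀ i ∈ s, i < s.card := by
    intro i hi
    have : Finset.range (i + 1) ⊆ s := fun j hj =>
      h i hi j (Nat.lt_succ_iff.1 (Finset.mem_range.1 hj))
    have := Finset.card_le_card this
    rw [Finset.card_range] at this
    omega
  exact Finset.eq_of_subset_of_card_le (fun i hi => Finset.mem_range.2 (hsub i hi)) (by simp)

/-- The number of the first `m` design points that are at most `t`. -/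
noncomputable def designCount (m : ℕ) (x : ℕ → ℝ) (t : ℝ) : ℕ :=
  ((Finset.range m).filter fun i => x i ≤ t).card

theorem designCount_le (m : ℕ) (x : ℕ → ℝ) (t : ℝ) : designCount m x t ≤ m := by
  simpa [designCount] using
    Finset.card_filter_le (Finset.range m) fun i => x i ≤ t

theorem designCount_mono (m : ℕ) (x : ℕ → ℝ) : Monotone (designCount m x) := by
  intro s t hst
  refine Finset.card_le_card fun i hi => ?_
  rw [Finset.mem_filter] at hi ⊢
  exact ⟨hi.1, hi.2.trans hst⟩

theorem le_iff_lt_designCount {m : ℕ} {x : ℕ → ℝ} (hx : StrictMonoOn x (Set.Iio m)) {t : ℝ}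
    {i : ℕ} (hi : i < m) : x i ≤ t ↔ i < designCount m x t := by
  have h := eq_range_card_of_forall_le_mem (s := (Finset.range m).filter fun i => x i ≤ t) (by
    intro i hi j hj
    rw [Finset.mem_filter, Finset.mem_range] at hi ⊢
    have hj' : j < m := by omega
    exact ⟨hj', (hx.monotoneOn hj' hi.1 hj).trans hi.2⟩)
  have := Finset.ext_iff.1 h i
  simpa [hi, designCount] using this

/-- If the isotonic regression is still below `θ` at `b`, the errors have a large negative average
over some block of design points to the right of `a`. -/
theorem IsIsotonicRegression.exists_block_right {m : ℕ} {x f e : ℕ → ℝ} {u : ℝ → ℝ}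
    (hx : ∀ i < m, x i ∈ Set.Icc (0 : ℝ) 1) (hxm : StrictMonoOn x (Set.Iio m))
    (hu : IsIsotonicRegression m x (fun i => f i + e i) u) {a c b θ Δ : ℝ} {N : ℕ}
    (hb : b ∈ Set.Icc (0 : ℝ) 1) (hac : a ≤ c) (hub : u b < θ) (hΔ : 0 ≤ Δ)
    (hf : ∀ i < m, a < x i → θ ≤ f i) (hf' : ∀ i < m, c < x i → θ + Δ ≤ f i) (hN : 0 < N)
    (hN1 : designCount m x c + N ≤ designCount m x b)
    (hN2 : designCount m x c ≤ designCount m x a + 2 * N) :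
    ∃ k, N ≤ k ∧ k ≤ m - designCount m x a ∧
      Δ / 3 * k ≤ |∑ j ∈ Finset.range k, e (designCount m x a + j)| := by
  set i₀ := designCount m x a with hi₀
  set i₁ := designCount m x c with hi₁
  have h01 : i₀ ≤ i₁ := designCount_mono m x hac
  set B := (Finset.range m).filter fun i => x i ≤ a ∨ u (x i) < θ with hB
  have hBr : B = Finset.range B.card := by
    refine eq_range_card_of_forall_le_mem fun i hi j hj => ?_
    rw [hB, Finset.mem_filter, Finset.mem_range] at hi ⊢
    have hj' : j < m := by omega
    have hxx := hxm.monotoneOn (Set.mem_Iio.2 hj') (Set.mem_Iio.2 hi.1) hj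
    exact ⟨hj', hi.2.imp (fun h => hxx.trans h)
      (fun h => (hu.1 (hx j hj') (hx i hi.1) hxx).trans_lt h)⟩
  have hBm : B.card ≤ m := by
    simpa using Finset.card_filter_le (Finset.range m) fun i => x i ≤ a ∨ u (x i) < θ
  have hbB : designCount m x b ≤ B.card := by
    refine Finset.card_le_card fun i hi => ?_
    rw [Finset.mem_filter, Finset.mem_range] at hi ⊢
    exact ⟨hi.1, Or.inr ((hu.1 (hx i hi.1) hb hi.2).trans_lt hub)⟩
  have hE : (Finset.range m).filter (fun i => a < x i ∧ u (x i) < θ) = Finset.Ico i₀ B.card := by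
    ext i
    by_cases him : i < m
    · have h1 := le_iff_lt_designCount hxm (t := a) him
      have h2 : i ∈ B ↔ i < B.card := by conv_lhs => rw [hBr, Finset.mem_range]
      rw [hB, Finset.mem_filter, ← hB, Finset.mem_range] at h2
      rw [Finset.mem_filter, Finset.mem_range, Finset.mem_Ico, ← not_lt, ← h1, ← h2, not_le]
      constructor
      · rintro ⟨_, h3, h4⟩; exact ⟨h3, him, Or.inr h4⟩
      · rintro ⟨h3, _, h4⟩; exact ⟨him, h3, h4.resolve_left (not_le.2 h3)⟩
    · simp only [Finset.mem_filter, Finset.mem_range, him, false_and, Finset.mem_Ico, false_iff]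
      omega
  have hsum := hu.sum_sub_nonpos a θ
  -- On the block the fit is below θ, so replacing it by θ only decreases the residuals.
  have hle : ∑ i ∈ Finset.Ico i₀ B.card, (f i - θ + e i) ≤ 0 := by
    rw [hE] at hsum
    refine le_trans (Finset.sum_le_sum fun i hi => ?_) hsum
    rw [← hE, Finset.mem_filter] at hi
    linarith [hi.2.2]
  rw [Finset.sum_add_distrib, ← Finset.sum_Ico_consecutive _ h01 (by omega : i₁ ≤ B.card)] at hle
  have hs1 : 0 ≤ ∑ i ∈ Finset.Ico i₀ i₁, (f i - θ) := by
    refine Finset.sum_nonneg fun i hi => ?_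
    rw [Finset.mem_Ico] at hi
    have him : i < m := by omega
    have := hf i him (not_le.1 fun h => absurd ((le_iff_lt_designCount hxm him).1 h) (by omega))
    linarith
  have hs2 : ((B.card - i₁ : ℕ) : ℝ) * Δ ≤ ∑ i ∈ Finset.Ico i₁ B.card, (f i - θ) := by
    rw [← nsmul_eq_mul, ← Nat.card_Ico]
    refine Finset.card_nsmul_le_sum _ _ _ fun i hi => ?_
    rw [Finset.mem_Ico] at hi
    have him : i < m := by omega
    have := hf' i him (not_le.1 fun h => absurd ((le_iff_lt_designCount hxm him).1 h) (by omega))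
    linarith
  refine ⟨B.card - i₀, by omega, by omega, ?_⟩
  -- At most 2N block points lie in (a, c] and at least N lie beyond c, so the points with margin Δ
  -- make up at least a third of the block.
  have h3 : ((B.card - i₀ : ℕ) : ℝ) ≤ 3 * ((B.card - i₁ : ℕ) : ℝ) := by
    have : B.card - i₀ ≤ 3 * (B.card - i₁) := by omega
    exact_mod_cast this
  rw [← Finset.sum_Ico_eq_sum_range]
  have h4 := neg_le_abs (∑ i ∈ Finset.Ico i₀ B.card, e i)
  have h5 : Δ / 3 * ((B.card - i₀ : ℕ) : ℝ) ≤ Δ / 3 * (3 * ((B.card - i₁ : ℕ) : ℝ)) := by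
    gcongr
  linarith

/-- If the isotonic regression already exceeds `θ` at `a`, the errors have a large positive average
over some block of design points to the left of `b`. -/
theorem IsIsotonicRegression.exists_block_left {m : ℕ} {x f e : ℕ → ℝ} {u : ℝ → ℝ}
    (hx : ∀ i < m, x i ∈ Set.Icc (0 : ℝ) 1) (hxm : StrictMonoOn x (Set.Iio m))
    (hu : IsIsotonicRegression m x (fun i => f i + e i) u) {a c b θ Δ : ℝ} {N : ℕ}
    (ha : a ∈ Set.Icc (0 : ℝ) 1) (hcb : c ≤ b) (hua : θ < u a) (hΔ : 0 ≤ Δ)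
    (hf : ∀ i < m, x i ≤ b → f i ≤ θ) (hf' : ∀ i < m, x i ≤ c → f i ≤ θ - Δ) (hN : 0 < N)
    (hN1 : designCount m x a + N ≤ designCount m x c)
    (hN2 : designCount m x b ≤ designCount m x c + 2 * N) :
    ∃ k, N ≤ k ∧ k ≤ designCount m x b ∧
      Δ / 3 * k ≤ |∑ j ∈ Finset.range k, e (designCount m x b - 1 - j)| := by
  set i₂ := designCount m x b with hi₂
  set i₁ := designCount m x c with hi₁
  have h12 : i₁ ≤ i₂ := designCount_mono m x hcb
  have hi₂m : i₂ ≤ m := designCount_le m x b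
  set B := (Finset.range m).filter fun i => x i ≤ b ∧ u (x i) ≤ θ with hB
  have hBr : B = Finset.range B.card := by
    refine eq_range_card_of_forall_le_mem fun i hi j hj => ?_
    rw [hB, Finset.mem_filter, Finset.mem_range] at hi ⊢
    have hj' : j < m := by omega
    have hxx := hxm.monotoneOn (Set.mem_Iio.2 hj') (Set.mem_Iio.2 hi.1) hj
    exact ⟨hj', hxx.trans hi.2.1, (hu.1 (hx j hj') (hx i hi.1) hxx).trans hi.2.2⟩
  have hBa : B.card ≤ designCount m x a := by
    refine Finset.card_le_card fun i hi => ?_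
    rw [Finset.mem_filter, Finset.mem_range] at hi ⊢
    refine ⟨hi.1, ?_⟩
    by_contra! hlt
    exact absurd (hua.trans_le (hu.1 ha (hx i hi.1) hlt.le)) (not_lt.2 hi.2.2)
  have hE : (Finset.range m).filter (fun i => x i ≤ b ∧ θ < u (x i)) = Finset.Ico B.card i₂ := by
    ext i
    by_cases him : i < m
    · have h1 := le_iff_lt_designCount hxm (t := b) him
      have h2 : i ∈ B ↔ i < B.card := by conv_lhs => rw [hBr, Finset.mem_range]
      rw [hB, Finset.mem_filter, ← hB, Finset.mem_range] at h2
      rw [Finset.mem_filter, Finset.mem_range, Finset.mem_Ico, ← h1,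
        show B.card ≤ i ↔ ¬ i < B.card from not_lt.symm, ← h2]
      constructor
      · rintro ⟨_, h3, h4⟩; exact ⟨fun h => absurd h.2.2 (not_le.2 h4), h3⟩
      · rintro ⟨h3, h4⟩; exact ⟨him, h4, not_le.1 fun h => h3 ⟨him, h4, h⟩⟩
    · simp only [Finset.mem_filter, Finset.mem_range, him, false_and, Finset.mem_Ico, false_iff]
      omega
  have hsum := hu.sum_sub_nonneg b θ
  have hge : 0 ≤ ∑ i ∈ Finset.Ico B.card i₂, (f i - θ + e i) := by
    rw [hE] at hsum
    refine le_trans hsum (Finset.sum_le_sum fun i hi => ?_)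
    rw [← hE, Finset.mem_filter] at hi
    linarith [hi.2.2]
  rw [Finset.sum_add_distrib, ← Finset.sum_Ico_consecutive _ (by omega : B.card ≤ i₁) h12] at hge
  have hs1 : ∑ i ∈ Finset.Ico i₁ i₂, (f i - θ) ≤ 0 := by
    refine Finset.sum_nonpos fun i hi => ?_
    rw [Finset.mem_Ico] at hi
    have him : i < m := by omega
    have := hf i him ((le_iff_lt_designCount hxm him).2 (by omega))
    linarith
  have hs2 : ∑ i ∈ Finset.Ico B.card i₁, (f i - θ) ≤ ((i₁ - B.card : ℕ) : ℝ) * (-Δ) := by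
    rw [← nsmul_eq_mul, ← Nat.card_Ico]
    refine Finset.sum_le_card_nsmul _ _ _ fun i hi => ?_
    rw [Finset.mem_Ico] at hi
    have him : i < m := by omega
    have := hf' i him ((le_iff_lt_designCount hxm him).2 (by omega))
    linarith
  refine ⟨i₂ - B.card, by omega, by omega, ?_⟩
  have h3 : ((i₂ - B.card : ℕ) : ℝ) ≤ 3 * ((i₁ - B.card : ℕ) : ℝ) := by
    have : i₂ - B.card ≤ 3 * (i₁ - B.card) := by omega
    exact_mod_cast this
  -- The fixed end of this block is the right one, so the errors are summed backwards to make the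
  -- block an initial segment.
  have hrefl : ∑ j ∈ Finset.range (i₂ - B.card), e (i₂ - 1 - j)
      = ∑ i ∈ Finset.Ico B.card i₂, e i := by
    rw [Finset.sum_Ico_eq_sum_range, ← Finset.sum_range_reflect]
    refine Finset.sum_congr rfl fun j hj => ?_
    rw [Finset.mem_range] at hj
    congr 1
    omega
  rw [hrefl]
  have h4 := le_abs_self (∑ i ∈ Finset.Ico B.card i₂, e i)
  have h5 : Δ / 3 * ((i₂ - B.card : ℕ) : ℝ) ≤ Δ / 3 * (3 * ((i₁ - B.card : ℕ) : ℝ)) := by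
    gcongr
  linarith

/-- If the inverse estimate is off by more than `r`, the fit is off at `d ± r`. -/
theorem lt_or_le_of_lt_abs_inverseAt_sub {u : ℝ → ℝ} (hu : MonotoneOn u (Set.Icc 0 1))
    {θ d r : ℝ} (h0 : 0 ≤ d - r) (h1 : d + r ≤ 1) (hr : 0 ≤ r) (h : r < |inverseAt u θ - d|) :
    u (d + r) < θ ∨ θ ≤ u (d - r) := by
  by_contra! hcon
  obtain ⟨h2, h3⟩ := hcon
  have hbdd : BddBelow {x | x ∈ Set.Icc (0 : ℝ) 1 ∧ θ ≤ u x} := ⟨0, fun t ht => ht.1.1⟩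
  have hmem : d + r ∈ {x | x ∈ Set.Icc (0 : ℝ) 1 ∧ θ ≤ u x} := ⟨⟨by linarith, h1⟩, h2⟩
  have h4 : inverseAt u θ ≤ d + r := csInf_le hbdd hmem
  have h5 : d - r ≤ inverseAt u θ := by
    refine le_csInf ⟨_, hmem⟩ fun t ht => ?_
    by_contra! hlt
    have := hu ht.1 (⟨h0, by linarith⟩ : d - r ∈ Set.Icc (0 : ℝ) 1) hlt.le
    linarith [ht.2]
  rw [lt_abs] at h
  rcases h with h | h <;> linarith

/-! ### The rate of the first-stage estimator -/

/-- The multipliers `c n` may vary, so that the points f is evaluated at can be centred at an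
estimate of d rather than at d. -/
theorem HasDerivAt.tendsto_slope_mul {F : ℝ → ℝ} {F' d : ℝ} (hF : HasDerivAt F F' d) {r : ℕ → ℝ}
    (hr : Tendsto r atTop (𝓝 0)) (hr0 : ∀ᶠ n in atTop, 0 < r n) {c : ℕ → ℝ} {c₀ : ℝ}
    (hc : Tendsto c atTop (𝓝 c₀)) :
    Tendsto (fun n => (F (d + c n * r n) - F d) / r n) atTop (𝓝 (c₀ * F')) := by
  have h1 : Tendsto (fun n => d + c n * r n) atTop (𝓝 d) := by
    simpa using (hc.mul hr).const_add d
  have h2 := (hasDerivAt_iff_isLittleO.1 hF).comp_tendsto h1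
  have h3 : (fun n => d + c n * r n - d) =O[atTop] r := by
    simpa using (hc.isBigO_one ℝ).mul (isBigO_refl r atTop)
  have h4 := ((h2.trans_isBigO h3).tendsto_div_nhds_zero).add (hc.mul_const F')
  rw [zero_add] at h4
  refine h4.congr' ?_
  filter_upwards [hr0] with n hn
  simp only [Function.comp, smul_eq_mul]
  field_simp
  ring

theorem empiricalCDF_nonneg (m : ℕ) (x : ℕ → ℝ) (t : ℝ) : 0 ≤ empiricalCDF m x t := by
  unfold empiricalCDF; positivity

theorem empiricalCDF_le_one (m : ℕ) (x : ℕ → ℝ) (t : ℝ) : empiricalCDF m x t ≤ 1 := by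
  refine div_le_one_of_le₀ ?_ (Nat.cast_nonneg _)
  exact_mod_cast designCount_le m x t

/-- On windows of width r the increment of G is of order r, while the design error o(m^(-1/3)) is
o(r) because m r³ → ∞. -/
theorem DesignA1.exists_tendsto_designCount {m : ℕ → ℕ} {x : ℕ → ℕ → ℝ} {d₀ : ℝ}
    (hA1 : DesignA1 m x d₀) (hd₀ : d₀ ∈ Set.Ioo (0 : ℝ) 1) {r : ℕ → ℝ}
    (hr : Tendsto r atTop (𝓝 0)) (hr0 : ∀ᶠ n in atTop, 0 < r n)
    (hmr : Tendsto (fun n => (m n : ℝ) * r n ^ 3) atTop atTop) :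
    ∃ g : ℝ, 0 < g ∧ ∀ a b : ℝ, Tendsto (fun n =>
      ((designCount (m n) (x n) (d₀ + b * r n) : ℝ) - designCount (m n) (x n) (d₀ + a * r n))
        / (m n * r n)) atTop (𝓝 ((b - a) * g)) := by
  obtain ⟨ν, g, _, -, -, -, hder, hg, ho⟩ := hA1
  refine ⟨g d₀, hg, ?_⟩
  -- Without boundedness the real supremum would be 0 by default and would control nothing.
  have hbound : ∀ n, BddAbove (Set.range fun t : Set.Icc (0 : ℝ) 1 =>
      |empiricalCDF (m n) (x n) t - cdf ν t|) := by
    intro n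
    refine ⟨1, ?_⟩
    rintro _ ⟨t, rfl⟩
    have h1 := empiricalCDF_nonneg (m n) (x n) t
    have h2 := empiricalCDF_le_one (m n) (x n) t
    have h3 := cdf_nonneg ν t
    have h4 := cdf_le_one ν t
    exact abs_sub_le_iff.2 ⟨by linarith, by linarith⟩
  have hro : (fun n => (m n : ℝ) ^ (-(1 / 3) : ℝ)) =O[atTop] r := by
    refine IsBigO.of_bound 1 ?_
    filter_upwards [hr0, hmr.eventually_ge_atTop 1] with n hn hn1
    have hm : (0 : ℝ) < m n := by
      by_contra! h
      have : (m n : ℝ) * r n ^ 3 ≤ 0 := mul_nonpos_of_nonpos_of_nonneg h (by positivity)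
      linarith
    rw [one_mul, Real.norm_of_nonneg (by positivity), Real.norm_of_nonneg hn.le]
    refine le_of_pow_le_pow_left₀ (n := 3) (by norm_num) hn.le ?_
    rw [← Real.rpow_natCast, ← Real.rpow_mul hm.le]
    norm_num
    rw [Real.rpow_neg_one, inv_le_iff_one_le_mul₀ hm]
    linarith
  have hsup := (ho.trans_isBigO hro).tendsto_div_nhds_zero
  have hone : ∀ c : ℝ, Tendsto (fun n =>
      (empiricalCDF (m n) (x n) (d₀ + c * r n) - cdf ν d₀) / r n) atTop (𝓝 (c * g d₀)) := by
    intro c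
    have h1 := hder.tendsto_slope_mul hr hr0 (tendsto_const_nhds (x := c))
    have hin : ∀ᶠ n in atTop, d₀ + c * r n ∈ Set.Icc (0 : ℝ) 1 := by
      have : Tendsto (fun n => d₀ + c * r n) atTop (𝓝 d₀) := by
        simpa using (hr.const_mul c).const_add d₀
      exact this.eventually (Icc_mem_nhds hd₀.1 hd₀.2)
    have h2 : Tendsto (fun n => (empiricalCDF (m n) (x n) (d₀ + c * r n)
        - cdf ν (d₀ + c * r n)) / r n) atTop (𝓝 0) := by
      refine squeeze_zero_norm' ?_ hsup
      filter_upwards [hin, hr0] with n hn hrn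
      rw [norm_div, Real.norm_of_nonneg hrn.le]
      gcongr
      exact le_ciSup (hbound n) ⟨_, hn⟩
    have h3 := h2.add h1
    rw [zero_add] at h3
    refine h3.congr fun n => ?_
    ring
  intro a b
  have h := (hone b).sub (hone a)
  rw [← sub_mul] at h
  refine h.congr fun n => ?_
  rw [← sub_div, sub_sub_sub_cancel_right, empiricalCDF, empiricalCDF, ← sub_div, div_div]
  rfl

theorem partialSum_eq_sum_range {Ω : Type*} {M : ℕ} (e : ℕ → Ω → ℝ) {k : ℕ} (hk : k ≤ M) (ω : Ω) :
    partialSum (fun j : Fin M => e j) k ω = ∑ j ∈ Finset.range k, e j ω := by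
  induction k with
  | zero => simp [partialSum, indicesBelow]
  | succ k ih => rw [partialSum_succ hk, ih (by omega), Finset.sum_range_succ]

/-- A miss by more than r forces a noise average of at least f' r / 24 over more than g m r / 8
consecutive design points, starting at a fixed index. Hájek–Rényi bounds each of the two sides by a
constant over m r³. -/
theorem tendsto_measure_lt_abs_inverseAt_sub {Ω : Type*} [MeasurableSpace Ω] {P : Measure Ω}
    [IsProbabilityMeasure P] {d₀ : ℝ} (hd₀ : d₀ ∈ Set.Ioo (0 : ℝ) 1) {f : ℝ → ℝ}
    (hf : MonotoneOn f (Set.Icc 0 1)) {f' : ℝ} (hf' : 0 < f') (hder : HasDerivAt f f' d₀)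
    {m : ℕ → ℕ} (hmn : ∀ n, m n ≤ n) {x : ℕ → ℕ → ℝ}
    (hx : ∀ n, ∀ i < m n, x n i ∈ Set.Icc (0 : ℝ) 1)
    (hx_mono : ∀ n, StrictMonoOn (x n) (Set.Iio (m n))) (hA1 : DesignA1 m x d₀)
    {ε : ℕ → ℕ → Ω → ℝ} {v : ℝ} (hv0 : 0 ≤ v) (hε2 : ∀ n, ∀ i < n, MemLp (ε n i) 2 P)
    (hε0 : ∀ n, ∀ i < n, ∫ ω, ε n i ω ∂P = 0) (hεv : ∀ n, ∀ i < n, ∫ ω, ε n i ω ^ 2 ∂P = v)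
    (hind : ∀ n, iIndepFun (fun i : Fin n => ε n i) P) {fhat : ℕ → Ω → ℝ → ℝ}
    (hfhat : ∀ n ω, IsIsotonicRegression (m n) (x n) (fun i => f (x n i) + ε n i ω) (fhat n ω))
    {r : ℕ → ℝ} (hr : Tendsto r atTop (𝓝 0)) (hr0 : ∀ᶠ n in atTop, 0 < r n)
    (hmr : Tendsto (fun n => (m n : ℝ) * r n ^ 3) atTop atTop) :
    Tendsto (fun n => P {ω | r n < |inverseAt (fhat n ω) (f d₀) - d₀|}) atTop (𝓝 0) := by
  obtain ⟨g, hg, hcount⟩ := hA1.exists_tendsto_designCount hd₀ hr hr0 hmr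
  have hslope := fun c => hder.tendsto_slope_mul hr hr0 (tendsto_const_nhds (x := c))
  have hbound : Tendsto (fun n => ENNReal.ofReal
      (2 * (2 * v / (g / 8 * (f' / 24) ^ 2) * ((m n : ℝ) * r n ^ 3)⁻¹))) atTop (𝓝 0) := by
    have h1 := ((tendsto_inv_atTop_zero.comp hmr).const_mul
      (2 * v / (g / 8 * (f' / 24) ^ 2))).const_mul 2
    rw [mul_zero, mul_zero] at h1
    have := (ENNReal.continuous_ofReal.tendsto _).comp h1
    rwa [ENNReal.ofReal_zero] at this
  have hin : ∀ c : ℝ, ∀ᶠ n in atTop, d₀ + c * r n ∈ Set.Icc (0 : ℝ) 1 := by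
    intro c
    have : Tendsto (fun n => d₀ + c * r n) atTop (𝓝 d₀) := by
      simpa using (hr.const_mul c).const_add d₀
    exact this.eventually (Icc_mem_nhds hd₀.1 hd₀.2)
  -- The injection τ lets one bound serve the errors read rightwards from d₀ and leftwards from d₀ -
  -- r/2.
  have hpair : ∀ n k, ∀ (τ : Fin k → ℕ), Function.Injective τ → (∀ j, τ j < n) →
      ∀ N : ℕ, (m n : ℝ) * r n * (g / 8) ≤ N → 0 < (m n : ℝ) → 0 < r n →
      P.real (exceedance (fun j => ε n (τ j)) N (f' / 8 * r n / 3) k)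
        ≤ 2 * v / (g / 8 * (f' / 24) ^ 2) * ((m n : ℝ) * r n ^ 3)⁻¹ := by
    intro n k τ hτ hτn N hN hm hrn
    have hNpos : (0 : ℝ) < N := lt_of_lt_of_le (by positivity) hN
    have h1 : iIndepFun (fun j => ε n (τ j)) P :=
      (hind n).precomp (g := fun j => ⟨τ j, hτn j⟩) fun i j hij => hτ (Fin.mk.inj_iff.1 hij)
    refine (real_exceedance_le (fun j => hε2 n _ (hτn j)) h1 (fun j => hε0 n _ (hτn j)) hv0
      (fun j => hεv n _ (hτn j)) (by exact_mod_cast hNpos) (by positivity)).trans ?_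
    calc 2 * v / (N * (f' / 8 * r n / 3) ^ 2)
        ≤ 2 * v / ((m n : ℝ) * r n * (g / 8) * (f' / 8 * r n / 3) ^ 2) := by gcongr
      _ = _ := by field_simp; ring
  refine tendsto_of_tendsto_of_tendsto_of_le_of_le' tendsto_const_nhds hbound
    (.of_forall fun _ => zero_le) ?_
  -- The limits are g/2 and g/4 for the counts beyond c, and f'/2 and f'/4 for the margins; g/8 and
  -- f'/8 lie strictly below all of them. `c3` and `c4` say that the buffer between c and the fixed
  -- end holds at most 2N points.
  have c1 := (hcount (1 / 2) 1).eventually_const_lt (u := g / 8) (by linarith)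
  have c2 := (hcount (-1) (-3 / 4)).eventually_const_lt (u := g / 8) (by linarith)
  have c3 := (((hcount (1 / 2) 1).const_mul 2).sub (hcount 0 (1 / 2))).eventually_const_lt
    (u := 0) (by linarith)
  have c4 := (((hcount (-1) (-3 / 4)).const_mul 2).sub
    (hcount (-3 / 4) (-1 / 2))).eventually_const_lt (u := 0) (by linarith)
  have s1 := (hslope (1 / 2)).eventually_const_lt (u := f' / 8) (by linarith)
  have s2 := ((hslope (-1 / 2)).sub (hslope (-3 / 4))).eventually_const_lt (u := f' / 8)
    (by linarith)
  have s3 := (hslope (-1 / 2)).eventually_lt_const (u := 0) (by linarith)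
  filter_upwards [c1, c2, c3, c4, s1, s2, s3, hr0, hmr.eventually_gt_atTop 0, hin 1, hin (-1),
    hin (1 / 2), hin (-1 / 2), hin (-3 / 4)] with n c1 c2 c3 c4 s1 s2 s3 hrn hmrn i1 i2 i3 i4 i5
  have hm : (0 : ℝ) < m n := by
    by_contra! h
    have : (m n : ℝ) * r n ^ 3 ≤ 0 := mul_nonpos_of_nonpos_of_nonneg h (by positivity)
    linarith
  have hmrp : 0 < (m n : ℝ) * r n := by positivity
  set cnt : ℝ → ℕ := fun c => designCount (m n) (x n) (d₀ + c * r n) with hcnt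
  have hcm : ∀ a b : ℝ, a ≤ b → cnt a ≤ cnt b := fun a b hab =>
    designCount_mono _ _ (by have := mul_le_mul_of_nonneg_right hab hrn.le; linarith)
  have e1 := hcm (1 / 2) 1 (by norm_num)
  have e2 := hcm (-1) (-3 / 4) (by norm_num)
  change g / 8 < ((cnt 1 : ℝ) - cnt (1 / 2)) / _ at c1
  change g / 8 < ((cnt (-3 / 4) : ℝ) - cnt (-1)) / _ at c2
  change 0 < 2 * (((cnt 1 : ℝ) - cnt (1 / 2)) / _) - ((cnt (1 / 2) : ℝ) - cnt 0) / _ at c3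
  change 0 < 2 * (((cnt (-3 / 4) : ℝ) - cnt (-1)) / _)
    - ((cnt (-1 / 2) : ℝ) - cnt (-3 / 4)) / _ at c4
  rw [lt_div_iff₀ hmrp, ← Nat.cast_sub e1] at c1
  rw [lt_div_iff₀ hmrp, ← Nat.cast_sub e2] at c2
  rw [← mul_div_assoc, ← sub_div, div_pos_iff_of_pos_right hmrp] at c3 c4
  rw [lt_div_iff₀ hrn] at s1
  rw [← sub_div, lt_div_iff₀ hrn] at s2
  rw [div_lt_iff₀ hrn, zero_mul] at s3
  have hR := hpair n (m n - cnt 0) (fun j => cnt 0 + j)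
    (fun i j hij => Fin.ext (by simpa using hij)) (fun j => by have := hmn n; have := j.2; omega)
    (cnt 1 - cnt (1 / 2)) (by linarith) hm hrn
  have hL := hpair n (cnt (-1 / 2)) (fun j => cnt (-1 / 2) - 1 - j)
    (fun i j hij => Fin.ext (by
      have h1 := i.2; have h2 := j.2
      have h3 : cnt (-1 / 2) - 1 - (i : ℕ) = cnt (-1 / 2) - 1 - (j : ℕ) := hij
      omega))
    (fun j => by
      have := hmn n; have := j.2
      have := designCount_le (m n) (x n) (d₀ + (-1 / 2) * r n)
      change cnt (-1 / 2) ≤ m n at this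
      omega)
    (cnt (-3 / 4) - cnt (-1)) (by linarith) hm hrn
  set ER := exceedance (fun j : Fin (m n - cnt 0) => ε n (cnt 0 + j)) (cnt 1 - cnt (1 / 2))
    (f' / 8 * r n / 3) (m n - cnt 0) with hER
  set EL := exceedance (fun j : Fin (cnt (-1 / 2)) => ε n (cnt (-1 / 2) - 1 - j))
    (cnt (-3 / 4) - cnt (-1)) (f' / 8 * r n / 3) (cnt (-1 / 2)) with hEL
  have hNR : 0 < cnt 1 - cnt (1 / 2) := by
    have : (0 : ℝ) < (cnt 1 - cnt (1 / 2) : ℕ) := lt_trans (by positivity) c1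
    exact_mod_cast this
  have hNL : 0 < cnt (-3 / 4) - cnt (-1) := by
    have : (0 : ℝ) < (cnt (-3 / 4) - cnt (-1) : ℕ) := lt_trans (by positivity) c2
    exact_mod_cast this
  have hsub : {ω | r n < |inverseAt (fhat n ω) (f d₀) - d₀|} ⊆ ER ∪ EL := by
    intro ω hω
    have hd0 : d₀ ∈ Set.Icc (0 : ℝ) 1 := ⟨hd₀.1.le, hd₀.2.le⟩
    rcases lt_or_le_of_lt_abs_inverseAt_sub (hfhat n ω).1 (by linarith [i2.1]) (by linarith [i1.2])
      hrn.le hω with hlt | hge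
    · left
      obtain ⟨k, hk1, hk2, hk3⟩ := (hfhat n ω).exists_block_right (hx n) (hx_mono n)
        (f := fun i => f (x n i)) (e := fun i => ε n i ω)
        (a := d₀ + 0 * r n) (c := d₀ + 1 / 2 * r n) (b := d₀ + 1 * r n) (θ := f d₀)
        (Δ := f' / 8 * r n) (N := cnt 1 - cnt (1 / 2)) i1 (by linarith) (by rwa [one_mul])
        (by positivity)
        (fun i hi hlt => hf hd0 (hx n i hi) (by linarith))
        (fun i hi hlt => by
          have := hf i3 (hx n i hi) hlt.le
          linarith)
        hNR (by change cnt (1 / 2) + _ ≤ cnt 1; omega)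
        (by
          change cnt (1 / 2) ≤ cnt 0 + _
          rw [← Nat.cast_sub e1] at c3
          have : ((cnt (1 / 2) : ℕ) : ℝ) ≤ ((cnt 0 + 2 * (cnt 1 - cnt (1 / 2)) : ℕ) : ℝ) := by
            push_cast [e1] at c3 ⊢; linarith
          exact_mod_cast this)
      refine ⟨k, hk1, hk2, ?_⟩
      rw [partialSum_eq_sum_range (fun j => ε n (cnt 0 + j)) hk2]
      exact hk3
    · right
      -- The fit at d₀ - r is only known to be at least f(d₀), whereas a strict inequality is
      -- needed. The level is therefore lowered to f(d₀ - r/2), which is below f(d₀) by `s3`.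
      obtain ⟨k, hk1, hk2, hk3⟩ := (hfhat n ω).exists_block_left (hx n) (hx_mono n)
        (f := fun i => f (x n i)) (e := fun i => ε n i ω)
        (a := d₀ + (-1) * r n) (c := d₀ + (-3 / 4) * r n) (b := d₀ + (-1 / 2) * r n)
        (θ := f (d₀ + (-1 / 2) * r n))
        (Δ := f' / 8 * r n) (N := cnt (-3 / 4) - cnt (-1)) i2 (by linarith)
        (by
          have : d₀ + (-1) * r n = d₀ - r n := by ring
          rw [this]; linarith)
        (by positivity)
        (fun i hi hle => hf (hx n i hi) i4 hle)
        (fun i hi hle => by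
          have := hf (hx n i hi) i5 hle
          linarith)
        hNL (by change cnt (-1) + _ ≤ cnt (-3 / 4); omega)
        (by
          change cnt (-1 / 2) ≤ cnt (-3 / 4) + _
          have : ((cnt (-1 / 2) : ℕ) : ℝ)
              ≤ ((cnt (-3 / 4) + 2 * (cnt (-3 / 4) - cnt (-1)) : ℕ) : ℝ) := by
            push_cast [e2]; linarith
          exact_mod_cast this)
      refine ⟨k, hk1, hk2, ?_⟩
      rw [partialSum_eq_sum_range (fun j => ε n (cnt (-1 / 2) - 1 - j)) hk2]
      exact hk3
  calc P {ω | r n < |inverseAt (fhat n ω) (f d₀) - d₀|} ≤ P (ER ∪ EL) := measure_mono hsub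
    _ = ENNReal.ofReal (P.real (ER ∪ EL)) := (ofReal_measureReal).symm
    _ ≤ _ := by
      refine ENNReal.ofReal_le_ofReal ((measureReal_union_le _ _).trans ?_)
      linarith

/-! ### Sample moments of the second-stage errors -/

theorem memLp_comp_of_hasLaw {Ω : Type*} [MeasurableSpace Ω] {P : Measure Ω} {ρ : Measure ℝ}
    {X : Ω → ℝ} (hX : HasLaw X ρ P) {φ : ℝ → ℝ} (hφ : MemLp φ 2 ρ) :
    MemLp (fun ω => φ (X ω)) 2 P := by
  rw [← hX.map_eq] at hφ
  exact hφ.comp_of_map hX.aemeasurable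

theorem measure_le_abs_average_sub_le {Ω : Type*} [MeasurableSpace Ω] {P : Measure Ω}
    [IsProbabilityMeasure P] {ρ : Measure ℝ} {k : ℕ} (hk : 0 < k) {X : Fin k → Ω → ℝ}
    (hX : ∀ i, HasLaw (X i) ρ P) (hind : iIndepFun X P) {φ : ℝ → ℝ} (hφm : Measurable φ)
    (hφ : MemLp φ 2 ρ) {η : ℝ} (hη : 0 < η) :
    P {ω | η ≤ |(k : ℝ)⁻¹ * ∑ i, φ (X i ω) - ∫ z, φ z ∂ρ|}
      ≤ ENNReal.ofReal (Var[φ; ρ] / (k * η ^ 2)) := by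
  have hk' : (0 : ℝ) < k := by exact_mod_cast hk
  have hρ : IsProbabilityMeasure ρ := by
    rw [← (hX ⟨0, hk⟩).map_eq]
    exact Measure.isProbabilityMeasure_map (hX ⟨0, hk⟩).aemeasurable
  have hL : ∀ i, MemLp (fun ω => φ (X i ω)) 2 P := fun i => memLp_comp_of_hasLaw (hX i) hφ
  have hmem : MemLp (fun ω => (k : ℝ)⁻¹ * ∑ i, φ (X i ω)) 2 P :=
    (memLp_finsetSum _ fun i _ => hL i).const_mul _
  have hint : ∀ i, ∫ ω, φ (X i ω) ∂P = ∫ z, φ z ∂ρ := fun i =>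
    (hX i).integral_comp hφ.aestronglyMeasurable
  have hmean : ∫ ω, (k : ℝ)⁻¹ * ∑ i, φ (X i ω) ∂P = ∫ z, φ z ∂ρ := by
    rw [integral_const_mul, integral_finsetSum _ fun i _ => (hL i).integrable (by norm_num)]
    simp only [hint, Finset.sum_const, Finset.card_univ, Fintype.card_fin, nsmul_eq_mul]
    field_simp
  have hvar1 : ∀ i, Var[fun ω => φ (X i ω); P] = Var[φ; ρ] := fun i => by
    rw [← (hX i).map_eq, variance_map hφm.aemeasurable (hX i).aemeasurable, Function.comp_def]
  have hvar : Var[fun ω => (k : ℝ)⁻¹ * ∑ i, φ (X i ω); P] = Var[φ; ρ] / k := by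
    rw [variance_const_mul]
    have h1 : Var[∑ i, fun ω => φ (X i ω); P] = ∑ i, Var[fun ω => φ (X i ω); P] :=
      IndepFun.variance_sum (fun i _ => hL i) fun i _ j _ hij =>
        (hind.indepFun hij).comp hφm hφm
    have h2 : (fun ω => ∑ i, φ (X i ω)) = ∑ i, fun ω => φ (X i ω) := by
      ext ω; simp
    rw [h2, h1]
    simp only [hvar1, Finset.sum_const, Finset.card_univ, Fintype.card_fin, nsmul_eq_mul]
    field_simp
  have := meas_ge_le_variance_div_sq hmem hη
  rw [hmean, hvar, div_div] at this
  exact this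

/-- The scale `s` covers two uses of Chebyshev's inequality: s = 1 is the weak law for sample
moments, and s = h shows that noise averages are negligible against the half-width. -/
theorem tendsto_measure_le_abs_average_sub {Ω : Type*} [MeasurableSpace Ω] {P : Measure Ω}
    [IsProbabilityMeasure P] {ρ : Measure ℝ} {k : ℕ → ℕ} {X : (n : ℕ) → Fin (k n) → Ω → ℝ}
    (hX : ∀ n i, HasLaw (X n i) ρ P) (hind : ∀ n, iIndepFun (X n) P) {φ : ℝ → ℝ}
    (hφm : Measurable φ) (hφ : MemLp φ 2 ρ) {s : ℕ → ℝ} (hs : ∀ᶠ n in atTop, 0 < s n)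
    (hks : Tendsto (fun n => (k n : ℝ) * s n ^ 2) atTop atTop) :
    ∀ η > 0, Tendsto (fun n => P {ω | η ≤
      |((k n : ℝ)⁻¹ * ∑ i, φ (X n i ω) - ∫ z, φ z ∂ρ) / s n|}) atTop (𝓝 0) := by
  intro η hη
  have hb : Tendsto (fun n => ENNReal.ofReal (Var[φ; ρ] / η ^ 2 * ((k n : ℝ) * s n ^ 2)⁻¹))
      atTop (𝓝 0) := by
    have h1 := (tendsto_inv_atTop_zero.comp hks).const_mul (Var[φ; ρ] / η ^ 2)
    rw [mul_zero] at h1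
    have := (ENNReal.continuous_ofReal.tendsto _).comp h1
    rwa [ENNReal.ofReal_zero] at this
  refine tendsto_of_tendsto_of_tendsto_of_le_of_le' tendsto_const_nhds hb
    (.of_forall fun _ => zero_le) ?_
  filter_upwards [hs, hks.eventually_gt_atTop 0] with n hn hkn
  have hk : 0 < k n := by
    refine Nat.pos_of_ne_zero fun h => ?_
    rw [h] at hkn
    simp at hkn
  have h2 := measure_le_abs_average_sub_le hk (hX n) (hind n) hφm hφ (mul_pos hη hn)
  refine (measure_mono fun ω hω => ?_).trans (h2.trans (ENNReal.ofReal_le_ofReal (le_of_eq ?_)))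
  · have h3 : η ≤ |_ / s n| := hω
    rw [abs_div, abs_of_pos hn, le_div_iff₀ hn] at h3
    exact h3
  · field_simp

/-- A statistic that vanishes along every sequence on which finitely many other statistics converge
to constants tends to zero in measure as soon as those statistics converge in measure. -/
theorem tendstoInMeasure_of_forall_seq {Ω : Type*} [MeasurableSpace Ω] {P : Measure Ω}
    {ι : Type*} [Fintype ι] {T : ι → ℕ → Ω → ℝ} {c : ι → ℝ}
    (hT : ∀ j, ∀ η > 0, Tendsto (fun n => P {ω | η ≤ |T j n ω - c j|}) atTop (𝓝 0))
    {D : ℕ → Ω → ℝ}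
    (hD : ∀ (n : ℕ → ℕ) (ω : ℕ → Ω), Tendsto n atTop atTop →
      (∀ j, Tendsto (fun k => T j (n k) (ω k)) atTop (𝓝 (c j))) →
      Tendsto (fun k => D (n k) (ω k)) atTop (𝓝 0)) :
    TendstoInMeasure P D atTop (fun _ => 0) := by
  rw [tendstoInMeasure_iff_dist]
  intro η hη
  -- Otherwise there are n_k ≥ k and ω_k with all statistics within 1/(k+1) of their limits but |D|
  -- ≥ η, against `hD`. The sample point may change with k, and no measurability of `D` is needed.
  obtain ⟨N, δ, hδ, hNδ⟩ : ∃ (N : ℕ) (δ : ℝ), 0 < δ ∧ ∀ n ≥ N, ∀ ω,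
      (∀ j, |T j n ω - c j| < δ) → |D n ω| < η := by
    by_contra! hcon
    choose n hn ω hω hηω using fun k : ℕ => hcon k (1 / ((k : ℝ) + 1)) (by positivity)
    have h1 : Tendsto n atTop atTop := tendsto_atTop_mono hn tendsto_id
    have h2 : ∀ j, Tendsto (fun k => T j (n k) (ω k)) atTop (𝓝 (c j)) := by
      intro j
      rw [tendsto_iff_norm_sub_tendsto_zero]
      refine squeeze_zero (fun _ => norm_nonneg _) (fun k => ?_)
        tendsto_one_div_add_atTop_nhds_zero_nat
      exact (hω k j).le
    have h3 := ((hD n ω h1 h2).norm).eventually_lt_const (u := η) (by simpa using hη)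
    obtain ⟨k, hk⟩ := h3.exists
    exact absurd hk (not_lt.2 (hηω k))
  have hsum : Tendsto (fun n => ∑ j, P {ω | δ ≤ |T j n ω - c j|}) atTop (𝓝 0) := by
    simpa using tendsto_finsetSum Finset.univ fun j _ => hT j δ hδ
  refine tendsto_of_tendsto_of_tendsto_of_le_of_le' tendsto_const_nhds hsum
    (.of_forall fun _ => zero_le) ?_
  filter_upwards [eventually_ge_atTop N] with n hn
  refine (measure_mono (t := ⋃ j, {ω | δ ≤ |T j n ω - c j|}) fun ω hω => ?_).trans
    (measure_iUnion_fintype_le _ _)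
  by_contra hnot
  simp only [Set.mem_iUnion, not_exists] at hnot
  have h1 := hNδ n hn ω fun j => not_le.1 (hnot j)
  have h2 : η ≤ dist (D n ω) 0 := hω
  rw [Real.dist_eq, sub_zero] at h2
  linarith

/-! ### Sample sizes -/

theorem stageOneSize_le {p : ℝ} (hp1 : p < 1) (n : ℕ) : stageOneSize p n ≤ n := by
  have := stageOneSize_add_two_mul p hp1 n
  omega

theorem abs_stageOneSize_sub_le {p : ℝ} (hp0 : 0 < p) (n : ℕ) :
    |(stageOneSize p n : ℝ) - n * p| ≤ 1 := by
  have h1 : (⌊(n : ℝ) * p⌋₊ : ℝ) ≤ n * p := Nat.floor_le (by positivity)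
  have h2 : (n : ℝ) * p < ⌊(n : ℝ) * p⌋₊ + 1 := Nat.lt_floor_add_one _
  rw [abs_le]
  unfold stageOneSize
  split_ifs
  · constructor <;> linarith
  · push_cast; constructor <;> linarith

theorem tendsto_stageOneSize_div {p : ℝ} (hp0 : 0 < p) :
    Tendsto (fun n : ℕ => (stageOneSize p n : ℝ) / n) atTop (𝓝 p) := by
  have h1 : Tendsto (fun n : ℕ => ((stageOneSize p n : ℝ) - n * p) / n) atTop (𝓝 0) := by
    refine squeeze_zero_norm (fun n => ?_) tendsto_one_div_atTop_nhds_zero_nat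
    rw [norm_div, Real.norm_natCast]
    gcongr
    exact abs_stageOneSize_sub_le hp0 n
  have h2 := h1.add_const p
  rw [zero_add] at h2
  refine h2.congr' ?_
  filter_upwards [eventually_gt_atTop 0] with n hn
  have : (n : ℝ) ≠ 0 := by positivity
  field_simp
  ring

theorem tendsto_stageTwoSize_div {p : ℝ} (hp : p ∈ Set.Ioo (0 : ℝ) 1) :
    Tendsto (fun n : ℕ => (stageTwoSize p n : ℝ) / n) atTop (𝓝 ((1 - p) / 2)) := by
  refine (((tendsto_stageOneSize_div hp.1).const_sub 1).div_const 2).congr' ?_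
  filter_upwards [eventually_gt_atTop 0] with n hn
  have h1 : (n : ℝ) ≠ 0 := by positivity
  have h2 : (stageOneSize p n : ℝ) + 2 * stageTwoSize p n = n := by
    exact_mod_cast stageOneSize_add_two_mul p hp.2 n
  rw [← h2] at h1 ⊢
  field_simp
  ring

theorem tendsto_atTop_of_tendsto_div {a : ℕ → ℝ} {q : ℝ} (hq : 0 < q)
    (h : Tendsto (fun n : ℕ => a n / n) atTop (𝓝 q)) : Tendsto a atTop atTop := by
  refine (h.pos_mul_atTop hq tendsto_natCast_atTop_atTop).congr' ?_
  filter_upwards [eventually_gt_atTop 0] with n hn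
  have : (n : ℝ) ≠ 0 := by positivity
  field_simp

/-! ### Sample moments under translation -/

theorem sampleMean_const_add {m : ℕ} (hm : m ≠ 0) (a : ℝ) (e : Fin m → ℝ) :
    sampleMean (fun i => a + e i) = a + sampleMean e := by
  rw [sampleMean_eq_add hm _ a, sampleMean]
  simp

theorem sampleVar_const_add {m : ℕ} (hm : m ≠ 0) (a : ℝ) (e : Fin m → ℝ) :
    sampleVar (fun i => a + e i) = (m : ℝ)⁻¹ * ∑ i, e i ^ 2 - sampleMean e ^ 2 := by
  have hm' : (m : ℝ) ≠ 0 := by exact_mod_cast hm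
  have h1 : ∑ i, e i = m * sampleMean e := by rw [sampleMean]; field_simp
  rw [sampleVar, sampleMean_const_add hm]
  simp only [add_sub_add_left_eq_sub, sub_sq, Finset.sum_add_distrib, Finset.sum_sub_distrib,
    ← Finset.sum_mul, ← Finset.mul_sum, h1]
  simp only [Finset.sum_const, Finset.card_univ, Fintype.card_fin, nsmul_eq_mul]
  field_simp
  ring

theorem sampleThird_const_add_le {m : ℕ} (hm : m ≠ 0) (a : ℝ) (e : Fin m → ℝ) :
    sampleThird (fun i => a + e i)
      ≤ 4 * ((m : ℝ)⁻¹ * ∑ i, |e i| ^ 3) + 4 * |sampleMean e| ^ 3 := by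
  have hm' : (m : ℝ) ≠ 0 := by exact_mod_cast hm
  rw [sampleThird, sampleMean_const_add hm]
  simp only [add_sub_add_left_eq_sub]
  have h1 : ∀ i, |e i - sampleMean e| ^ 3 ≤ 4 * |e i| ^ 3 + 4 * |sampleMean e| ^ 3 := by
    intro i
    have h2 := abs_sub (e i) (sampleMean e)
    have h3 := abs_nonneg (e i)
    have h4 := abs_nonneg (sampleMean e)
    refine (pow_le_pow_left₀ (abs_nonneg _) h2 3).trans ?_
    -- The identity used is 4a³ + 4b³ - (a + b)³ = 3 (a + b)(a - b)².
    nlinarith [mul_nonneg (add_nonneg h3 h4) (sq_nonneg (|e i| - |sampleMean e|))]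
  calc (m : ℝ)⁻¹ * ∑ i, |e i - sampleMean e| ^ 3
      ≤ (m : ℝ)⁻¹ * ∑ i, (4 * |e i| ^ 3 + 4 * |sampleMean e| ^ 3) := by
        gcongr with i; exact h1 i
    _ = _ := by
        rw [Finset.sum_add_distrib, ← Finset.mul_sum]
        simp only [Finset.sum_const, Finset.card_univ, Fintype.card_fin, nsmul_eq_mul]
        field_simp

/-! ### The main theorem -/

theorem memLp_two_of_integrable_pow_six {ρ : Measure ℝ} [IsProbabilityMeasure ρ]
    (h6 : Integrable (fun e => e ^ 6) ρ) {φ : ℝ → ℝ} (hφ : Measurable φ)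
    (hb : ∀ e, φ e ^ 2 ≤ 1 + e ^ 6) : MemLp φ 2 ρ := by
  rw [memLp_two_iff_integrable_sq hφ.aestronglyMeasurable]
  refine ((integrable_const 1).add h6).mono' (hφ.pow_const 2).aestronglyMeasurable
    (.of_forall fun e => ?_)
  rw [Real.norm_of_nonneg (sq_nonneg _)]
  exact hb e

theorem sq_le_one_add_pow_six (e : ℝ) : e ^ 2 ≤ 1 + e ^ 6 := by
  nlinarith [sq_nonneg (e ^ 2 - 1), sq_nonneg (e * (e ^ 2 - 1)), sq_nonneg e, sq_nonneg (e ^ 3)]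

theorem pow_four_le_one_add_pow_six (e : ℝ) : (e ^ 2) ^ 2 ≤ 1 + e ^ 6 := by
  nlinarith [sq_nonneg (e ^ 2 - 1), sq_nonneg (e * (e ^ 2 - 1)), sq_nonneg e, sq_nonneg (e ^ 3)]

theorem real_gaussianReal_mul_le (C t : ℝ) :
    (gaussianReal 0 1).real {z | C * z ≤ t}
      = (gaussianReal 0 (C ^ 2).toNNReal).real (Set.Iic t) := by
  have h := gaussianReal_map_const_mul (μ := 0) (v := 1) C
  rw [mul_zero, mul_one] at h
  have h2 : NNReal.mk (C ^ 2) (sq_nonneg C) = (C ^ 2).toNNReal :=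
    (Real.toNNReal_of_nonneg (sq_nonneg C)).symm
  rw [h2] at h
  rw [← h, map_measureReal_apply (by fun_prop) measurableSet_Iic]
  rfl

theorem theorem4 {Ω : Type*} [MeasurableSpace Ω] (P : Measure Ω) [IsProbabilityMeasure P]
    -- regression function and target
    (d₀ : ℝ) (hd₀ : d₀ ∈ Set.Ioo (0 : ℝ) 1) (f : ℝ → ℝ) (hf : ClassF d₀ f)
    -- tuning parameters
    (p K γ : ℝ) (hp : p ∈ Set.Ioo (0 : ℝ) 1) (hK : 0 < K) (hγ : γ ∈ Set.Ioo (0 : ℝ) (1 / 3))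
    -- first-stage design: row `n` has `n₁ = stageOneSize p n` increasing points in `[0,1]`
    (x : ℕ → ℕ → ℝ)
    (hx : ∀ n, ∀ i < stageOneSize p n, x n i ∈ Set.Icc (0 : ℝ) 1)
    (hx_mono : ∀ n, StrictMonoOn (x n) (Set.Iio (stageOneSize p n)))
    (hA1 : DesignA1 (stageOneSize p) x d₀)
    -- law of the errors: mean zero, variance `σ² > 0`, finite sixth moment
    (ρ : Measure ℝ) [IsProbabilityMeasure ρ] (σ : ℝ) (hσ : 0 < σ)
    (hA5 : Integrable (fun e => e ^ 6) ρ)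
    (hmean : ∫ e, e ∂ρ = 0) (hvar : ∫ e, e ^ 2 ∂ρ = σ ^ 2)
    -- triangular arrays of errors, independent within each row and all with law `ρ`
    (ε ε' ε'' : ℕ → ℕ → Ω → ℝ)
    (hlaw : ∀ n, ∀ i < n, HasLaw (ε n i) ρ P ∧ HasLaw (ε' n i) ρ P ∧ HasLaw (ε'' n i) ρ P)
    (hindep : ∀ n, iIndepFun
      (Sum.elim (fun i : Fin n => ε n i)
        (Sum.elim (fun i : Fin n => ε' n i) (fun i : Fin n => ε'' n i))) P)
    -- isotonic regression of the first-stage data, and first-stage estimate of `d₀`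
    (fhat : ℕ → Ω → ℝ → ℝ)
    (hfhat : ∀ n ω, IsIsotonicRegression (stageOneSize p n) (x n)
      (fun i => f (x n i) + ε n i ω) (fhat n ω))
    (dhat : ℕ → Ω → ℝ) (hdhat : ∀ n ω, dhat n ω = inverseAt (fhat n ω) (f d₀))
    -- half-width of the second-stage interval
    (h : ℕ → ℝ) (hh : ∀ n, h n = K * (stageOneSize p n : ℝ) ^ (-γ))
    -- second-stage responses at `L = dhat - h` and `U = dhat + h`
    (Y' Y'' : (n : ℕ) → Ω → Fin (stageTwoSize p n) → ℝ)
    (hY' : ∀ n ω i, Y' n ω i = f (dhat n ω - h n) + ε' n i ω)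
    (hY'' : ∀ n ω i, Y'' n ω i = f (dhat n ω + h n) + ε'' n i ω)
    -- the constant `C₂`
    (C₂ : ℝ) (hC₂ : C₂ = σ / (deriv f d₀ * (1 - p) ^ (1 / 2 : ℝ))) :
    TendstoInMeasure P
      (fun n ω => ⨆ t : ℝ,
        |bootstrapCDF n (f d₀) (dhat n ω) (h n) (Y' n ω) (Y'' n ω) t
          - (gaussianReal 0 1).real {z | C₂ * z ≤ t}|)
      atTop (fun _ => 0) := by
  obtain ⟨⟨hmono, hder⟩, -⟩ := hf
  have hd := hder.self_of_nhds
  have hfd : HasDerivAt f (deriv f d₀) d₀ := hd.1.hasDerivAt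
  have hf' : 0 < deriv f d₀ := hd.2.1
  -- sample sizes
  have hp1 : 0 < 1 - p := by linarith [hp.2]
  have hm1 := tendsto_stageOneSize_div hp.1
  have hm2 := tendsto_stageTwoSize_div hp
  have hm1top : Tendsto (fun n => (stageOneSize p n : ℝ)) atTop atTop :=
    tendsto_atTop_of_tendsto_div hp.1 hm1
  have hm2top : Tendsto (fun n => (stageTwoSize p n : ℝ)) atTop atTop :=
    tendsto_atTop_of_tendsto_div (by positivity) hm2
  have hm2nat : Tendsto (stageTwoSize p) atTop atTop := tendsto_natCast_atTop_iff.1 hm2top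
  have hm2le : ∀ n, stageTwoSize p n ≤ n := fun n => by
    have := stageOneSize_add_two_mul p hp.2 n
    omega
  have hR : Tendsto (fun n : ℕ => (n : ℝ) / stageTwoSize p n) atTop (𝓝 (2 / (1 - p))) := by
    have := hm2.inv₀ (by positivity)
    rw [inv_div] at this
    exact this.congr fun n => inv_div _ _
  -- the half-width
  have hh0 : Tendsto h atTop (𝓝 0) := by
    have := ((tendsto_rpow_neg_atTop hγ.1).comp hm1top).const_mul K
    rw [mul_zero] at this
    exact this.congr fun n => (hh n).symm
  have hhpos : ∀ᶠ n in atTop, 0 < h n := by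
    filter_upwards [hm1top.eventually_gt_atTop 0] with n hn
    rw [hh n]; positivity
  -- Since n₁ hᵏ is of order n₁^(1 - kγ), the condition γ < 1/3 covers k = 3, for the first-stage
  -- rate, and k = 2, for noise averages relative to h and for √n h → ∞.
  have hhpow : ∀ k : ℕ, (k : ℝ) * γ < 1 →
      Tendsto (fun n => (stageOneSize p n : ℝ) * h n ^ k) atTop atTop := by
    intro k hk
    have h1 := ((tendsto_rpow_atTop (y := 1 - k * γ) (by linarith)).comp hm1top).const_mul_atTop
      (pow_pos hK k)
    refine h1.congr' ?_
    filter_upwards [hm1top.eventually_gt_atTop 0] with n hn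
    rw [hh n, mul_pow, ← Real.rpow_mul_natCast hn.le, Function.comp, sub_eq_add_neg,
      Real.rpow_add hn, Real.rpow_one]
    ring_nf
  have hh3 := hhpow 3 (by push_cast; linarith [hγ.2])
  have hh2 := hhpow 2 (by push_cast; linarith [hγ.2])
  have hm2h2 : Tendsto (fun n => (stageTwoSize p n : ℝ) * h n ^ 2) atTop atTop := by
    have h1 := (hm2.div hm1 hp.1.ne').pos_mul_atTop (div_pos (by positivity) hp.1) hh2
    refine h1.congr' ?_
    filter_upwards [hm1top.eventually_gt_atTop 0, eventually_gt_atTop 0] with n hn hn0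
    have : (0 : ℝ) < n := by exact_mod_cast hn0
    simp only [Pi.div_apply]
    field_simp
  have hnh : Tendsto (fun n : ℕ => √(n : ℝ) * h n) atTop atTop := by
    have h1 : Tendsto (fun n : ℕ => √((stageOneSize p n : ℝ) * h n ^ 2)) atTop atTop :=
      Real.tendsto_sqrt_atTop.comp hh2
    refine tendsto_atTop_mono' _ ?_ h1
    filter_upwards [hhpos] with n hn
    rw [Real.sqrt_mul (Nat.cast_nonneg _), Real.sqrt_sq hn.le]
    gcongr
    exact stageOneSize_le hp.2 n
  -- the errors
  have hm6 : ∀ {φ : ℝ → ℝ}, Measurable φ → (∀ e, φ e ^ 2 ≤ 1 + e ^ 6) → MemLp φ 2 ρ :=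
    fun hφ hb => memLp_two_of_integrable_pow_six hA5 hφ hb
  have hφ1 : MemLp (fun e : ℝ => e) 2 ρ := hm6 measurable_id sq_le_one_add_pow_six
  have hφ2 : MemLp (fun e : ℝ => e ^ 2) 2 ρ :=
    hm6 (measurable_id.pow_const 2) pow_four_le_one_add_pow_six
  have hφ3 : MemLp (fun e : ℝ => |e| ^ 3) 2 ρ := by
    refine hm6 (by fun_prop) fun e => ?_
    rw [← abs_pow, sq_abs]
    nlinarith
  have hindε : ∀ n, iIndepFun (fun i : Fin n => ε n i) P := fun n =>
    (hindep n).precomp (g := Sum.inl) Sum.inl_injective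
  have hindε' : ∀ n, iIndepFun (fun i : Fin (stageTwoSize p n) => ε' n i) P := fun n =>
    (hindep n).precomp (g := fun i => Sum.inr (Sum.inl (Fin.castLE (hm2le n) i)))
      (Sum.inr_injective.comp (Sum.inl_injective.comp (Fin.castLE_injective _)))
  have hindε'' : ∀ n, iIndepFun (fun i : Fin (stageTwoSize p n) => ε'' n i) P := fun n =>
    (hindep n).precomp (g := fun i => Sum.inr (Sum.inr (Fin.castLE (hm2le n) i)))
      (Sum.inr_injective.comp (Sum.inr_injective.comp (Fin.castLE_injective _)))
  have hlaw' : ∀ n (i : Fin (stageTwoSize p n)), HasLaw (ε' n i) ρ P := fun n i =>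
    (hlaw n i (i.2.trans_le (hm2le n))).2.1
  have hlaw'' : ∀ n (i : Fin (stageTwoSize p n)), HasLaw (ε'' n i) ρ P := fun n i =>
    (hlaw n i (i.2.trans_le (hm2le n))).2.2
  have hone : Tendsto (fun n => (stageTwoSize p n : ℝ) * (1 : ℝ) ^ 2) atTop atTop := by
    simpa using hm2top
  let e' : (n : ℕ) → Ω → Fin (stageTwoSize p n) → ℝ := fun n ω i => ε' n i ω
  let e'' : (n : ℕ) → Ω → Fin (stageTwoSize p n) → ℝ := fun n ω i => ε'' n i ω
  -- the statistics whose limits determine the bootstrap distribution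
  let T : Fin 7 → ℕ → Ω → ℝ :=
    ![fun n ω => sampleMean (e' n ω) / h n, fun n ω => sampleMean (e'' n ω) / h n,
      fun n ω => (stageTwoSize p n : ℝ)⁻¹ * ∑ i, e' n ω i ^ 2,
      fun n ω => (stageTwoSize p n : ℝ)⁻¹ * ∑ i, e'' n ω i ^ 2,
      fun n ω => (stageTwoSize p n : ℝ)⁻¹ * ∑ i, |e' n ω i| ^ 3,
      fun n ω => (stageTwoSize p n : ℝ)⁻¹ * ∑ i, |e'' n ω i| ^ 3,
      fun n ω => (dhat n ω - d₀) / h n]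
  let c : Fin 7 → ℝ := ![0, 0, σ ^ 2, σ ^ 2, ∫ e, |e| ^ 3 ∂ρ, ∫ e, |e| ^ 3 ∂ρ, 0]
  have hdhat_rate : ∀ η > 0, Tendsto (fun n => P {ω | η ≤ |(dhat n ω - d₀) / h n - 0|}) atTop
      (𝓝 0) := by
    intro η hη
    -- Halving η turns the weak inequality of the event into the strict one of the rate bound.
    have hr : Tendsto (fun n => η / 2 * h n) atTop (𝓝 0) := by
      simpa using hh0.const_mul (η / 2)
    have hr0 : ∀ᶠ n in atTop, 0 < η / 2 * h n := by
      filter_upwards [hhpos] with n hn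
      positivity
    have hmr : Tendsto (fun n => (stageOneSize p n : ℝ) * (η / 2 * h n) ^ 3) atTop atTop := by
      refine (hh3.const_mul_atTop (by positivity : 0 < (η / 2) ^ 3)).congr fun n => ?_
      ring
    have hlim := tendsto_measure_lt_abs_inverseAt_sub hd₀ hmono hf' hfd
      (stageOneSize_le hp.2) hx hx_mono hA1 (sq_nonneg σ)
      (fun n i hi => memLp_comp_of_hasLaw (hlaw n i hi).1 hφ1)
      (fun n i hi => ((hlaw n i hi).1.integral_comp hφ1.aestronglyMeasurable).trans hmean)
      (fun n i hi => ((hlaw n i hi).1.integral_comp hφ2.aestronglyMeasurable).trans hvar)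
      hindε hfhat hr hr0 hmr
    refine tendsto_of_tendsto_of_tendsto_of_le_of_le' tendsto_const_nhds hlim
      (.of_forall fun _ => zero_le) ?_
    filter_upwards [hhpos] with n hn
    refine measure_mono fun ω hω => ?_
    have h1 : η ≤ |(dhat n ω - d₀) / h n - 0| := hω
    rw [sub_zero, abs_div, abs_of_pos hn, le_div_iff₀ hn] at h1
    change η / 2 * h n < |inverseAt (fhat n ω) (f d₀) - d₀|
    rw [← hdhat n ω]
    nlinarith
  have havg1 : ∀ {X : (n : ℕ) → Fin (stageTwoSize p n) → Ω → ℝ},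
      (∀ n i, HasLaw (X n i) ρ P) → (∀ n, iIndepFun (X n) P) → ∀ η > 0,
      Tendsto (fun n => P {ω | η ≤ |sampleMean (fun i => X n i ω) / h n - 0|}) atTop (𝓝 0) := by
    intro X hX hXi η hη
    have := tendsto_measure_le_abs_average_sub hX hXi measurable_id hφ1 hhpos hm2h2 η hη
    simpa only [hmean, sub_zero, id_eq, sampleMean] using this
  have havg : ∀ {X : (n : ℕ) → Fin (stageTwoSize p n) → Ω → ℝ},
      (∀ n i, HasLaw (X n i) ρ P) → (∀ n, iIndepFun (X n) P) → ∀ {φ : ℝ → ℝ}, Measurable φ →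
      MemLp φ 2 ρ → ∀ η > 0, Tendsto (fun n => P {ω | η ≤
        |(stageTwoSize p n : ℝ)⁻¹ * ∑ i, φ (X n i ω) - ∫ e, φ e ∂ρ|}) atTop (𝓝 0) := by
    intro X hX hXi φ hφm hφ η hη
    have := tendsto_measure_le_abs_average_sub hX hXi hφm hφ (.of_forall fun _ => one_pos) hone η hη
    simpa only [div_one] using this
  have hT : ∀ j, ∀ η > 0, Tendsto (fun n => P {ω | η ≤ |T j n ω - c j|}) atTop (𝓝 0) := by
    intro j
    fin_cases j
    · exact havg1 hlaw' hindε'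
    · exact havg1 hlaw'' hindε''
    · have := havg hlaw' hindε' (φ := fun e => e ^ 2) (measurable_id.pow_const 2) hφ2
      rw [hvar] at this
      exact this
    · have := havg hlaw'' hindε'' (φ := fun e => e ^ 2) (measurable_id.pow_const 2) hφ2
      rw [hvar] at this
      exact this
    · exact havg hlaw' hindε' (φ := fun e => |e| ^ 3) (by fun_prop) hφ3
    · exact havg hlaw'' hindε'' (φ := fun e => |e| ^ 3) (by fun_prop) hφ3
    · exact hdhat_rate
  -- From here on everything is deterministic, along indices and sample points at which the seven
  -- statistics converge.
  refine tendstoInMeasure_of_forall_seq hT fun n ω hn hTn => ?_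
  have t0 : Tendsto (fun k => sampleMean (e' (n k) (ω k)) / h (n k)) atTop (𝓝 0) := hTn 0
  have t1 : Tendsto (fun k => sampleMean (e'' (n k) (ω k)) / h (n k)) atTop (𝓝 0) := hTn 1
  have t2 : Tendsto (fun k => (stageTwoSize p (n k) : ℝ)⁻¹ * ∑ i, e' (n k) (ω k) i ^ 2) atTop
    (𝓝 (σ ^ 2)) := hTn 2
  have t3 : Tendsto (fun k => (stageTwoSize p (n k) : ℝ)⁻¹ * ∑ i, e'' (n k) (ω k) i ^ 2) atTop
    (𝓝 (σ ^ 2)) := hTn 3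
  have t4 : Tendsto (fun k => (stageTwoSize p (n k) : ℝ)⁻¹ * ∑ i, |e' (n k) (ω k) i| ^ 3) atTop
    (𝓝 (∫ e, |e| ^ 3 ∂ρ)) := hTn 4
  have t5 : Tendsto (fun k => (stageTwoSize p (n k) : ℝ)⁻¹ * ∑ i, |e'' (n k) (ω k) i| ^ 3) atTop
    (𝓝 (∫ e, |e| ^ 3 ∂ρ)) := hTn 5
  have t6 : Tendsto (fun k => (dhat (n k) (ω k) - d₀) / h (n k)) atTop (𝓝 0) := hTn 6
  have hhn := hh0.comp hn
  have hhnpos : ∀ᶠ k in atTop, 0 < h (n k) := hn.eventually hhpos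
  have hm0 : ∀ᶠ k in atTop, stageTwoSize p (n k) ≠ 0 :=
    (hm2nat.comp hn).eventually_ne_atTop 0
  have hY'eq : ∀ k, Y' (n k) (ω k)
      = fun i => f (dhat (n k) (ω k) - h (n k)) + e' (n k) (ω k) i := fun k =>
    funext fun i => hY' _ _ i
  have hY''eq : ∀ k, Y'' (n k) (ω k)
      = fun i => f (dhat (n k) (ω k) + h (n k)) + e'' (n k) (ω k) i := fun k =>
    funext fun i => hY'' _ _ i
  have smean : ∀ {e : (k : ℕ) → Fin (stageTwoSize p (n k)) → ℝ},
      Tendsto (fun k => sampleMean (e k) / h (n k)) atTop (𝓝 0) →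
      Tendsto (fun k => sampleMean (e k)) atTop (𝓝 0) := by
    intro e he
    have := he.mul hhn
    rw [zero_mul] at this
    refine this.congr' ?_
    filter_upwards [hhnpos] with k hk
    simp only [Function.comp]
    field_simp
  have hvarlim : ∀ {e : (k : ℕ) → Fin (stageTwoSize p (n k)) → ℝ} (a : ℕ → ℝ),
      Tendsto (fun k => sampleMean (e k) / h (n k)) atTop (𝓝 0) →
      Tendsto (fun k => (stageTwoSize p (n k) : ℝ)⁻¹ * ∑ i, e k i ^ 2) atTop (𝓝 (σ ^ 2)) →
      Tendsto (fun k => sampleVar (fun i => a k + e k i)) atTop (𝓝 (σ ^ 2)) := by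
    intro e a he he2
    have := he2.sub ((smean he).pow 2)
    rw [zero_pow two_ne_zero, sub_zero] at this
    refine this.congr' ?_
    filter_upwards [hm0] with k hk
    rw [sampleVar_const_add hk]
  have hthird : ∀ {e : (k : ℕ) → Fin (stageTwoSize p (n k)) → ℝ} (a : ℕ → ℝ),
      Tendsto (fun k => sampleMean (e k) / h (n k)) atTop (𝓝 0) →
      Tendsto (fun k => (stageTwoSize p (n k) : ℝ)⁻¹ * ∑ i, |e k i| ^ 3) atTop
        (𝓝 (∫ e, |e| ^ 3 ∂ρ)) →
      ∀ᶠ k in atTop, sampleThird (fun i => a k + e k i) ≤ 4 * (∫ e, |e| ^ 3 ∂ρ) + 1 := by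
    intro e a he he3
    have := (he3.const_mul 4).add (((smean he).abs.pow 3).const_mul 4)
    have := this.eventually_lt_const (u := 4 * (∫ e, |e| ^ 3 ∂ρ) + 1) (by simp)
    filter_upwards [hm0, this] with k hk hlt
    exact (sampleThird_const_add_le hk _ _).trans hlt.le
  have hslopes : ∀ s : ℝ, Tendsto (fun k => (f (dhat (n k) (ω k) + s * h (n k)) - f d₀) / h (n k))
      atTop (𝓝 (s * deriv f d₀)) := by
    intro s
    -- The point d̂ + s h is d₀ + c h with c = (d̂ - d₀)/h + s → s, so the first-stage error does
    -- not affect the limiting difference quotient.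
    have h1 : Tendsto (fun k => (dhat (n k) (ω k) - d₀) / h (n k) + s) atTop (𝓝 s) := by
      simpa using t6.add_const s
    refine (hfd.tendsto_slope_mul hhn hhnpos h1).congr' ?_
    filter_upwards [hhnpos] with k hk
    simp only [Function.comp]
    congr 3
    field_simp
    ring
  have hU := hslopes 1
  have hL := hslopes (-1)
  have hslope : Tendsto (fun k => lsSlope (h (n k)) (Y' (n k) (ω k)) (Y'' (n k) (ω k))) atTop
      (𝓝 (deriv f d₀)) := by
    have h1 := ((hU.sub hL).add (t1.sub t0)).div_const 2
    have h2 : (1 * deriv f d₀ - -1 * deriv f d₀ + (0 - 0)) / 2 = deriv f d₀ := by ring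
    rw [h2] at h1
    refine h1.congr' ?_
    filter_upwards [hhnpos, hm0] with k hk hmk
    rw [lsSlope_eq hmk, hY'eq, hY''eq, sampleMean_const_add hmk, sampleMean_const_add hmk,
      one_mul, neg_one_mul, ← sub_eq_add_neg]
    field_simp
    ring
  have hbias : Tendsto (fun k => (f d₀ - (sampleMean (Y' (n k) (ω k))
      + sampleMean (Y'' (n k) (ω k))) / 2) / h (n k)) atTop (𝓝 0) := by
    -- The contributions f'(d₀) and -f'(d₀) of the two symmetric points cancel, which leaves o(h).
    have h1 := ((hU.add hL).add (t1.add t0)).div_const (-2)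
    have h2 : (1 * deriv f d₀ + -1 * deriv f d₀ + (0 + 0)) / (-2) = 0 := by ring
    rw [h2] at h1
    refine h1.congr' ?_
    filter_upwards [hhnpos, hm0] with k hk hmk
    rw [hY'eq, hY''eq, sampleMean_const_add hmk, sampleMean_const_add hmk,
      one_mul, neg_one_mul, ← sub_eq_add_neg]
    field_simp
    ring
  have hmain := tendsto_iSup_bootstrapCDF_sub (hm2nat.comp hn)
    (hn.eventually_ne_atTop 0) (fun k => Y' (n k) (ω k)) (fun k => Y'' (n k) (ω k))
    (fun k => dhat (n k) (ω k)) (fun k => h (n k)) (θ := f d₀) (C := 4 * (∫ e, |e| ^ 3 ∂ρ) + 1)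
    hf' (by positivity : 0 < σ ^ 2) (div_pos two_pos hp1) (hR.comp hn) hhnpos
    (hnh.comp hn) hslope hbias
    (by simp only [hY'eq]; exact hvarlim _ t0 t2) (by simp only [hY''eq]; exact hvarlim _ t1 t3)
    (by simp only [hY'eq]; exact hthird _ t0 t4) (by simp only [hY''eq]; exact hthird _ t1 t5)
  -- Here 2/(1 - p) is the limit of n/n₂.
  have hC : 2 / (1 - p) / (2 * deriv f d₀ ^ 2) * σ ^ 2 = C₂ ^ 2 := by
    rw [hC₂, div_pow, mul_pow, ← Real.sqrt_eq_rpow, Real.sq_sqrt hp1.le]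
    field_simp
  rw [hC] at hmain
  simp only [real_gaussianReal_mul_le]
  exact hmain
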